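/- For $m\ge 1$ let $\mathrm{Spin}(m)$ be the spin group of Euclidean $\mathbb R^m$ (inside the Clifford algebra of $\mathbb R^m$), acting on $\mathbb R^m$ through the double cover $\mathrm{Spin}(m)\to SO(m)$, and let $e_0,e_1,\dots$ be the standard basis. Let $V_n$ be the space of orthonormal pairs $(u,v)$ in $\mathbb R^{2n+2}$; by $(u,v)\mapsto u$ it is an $S^{2n}$-bundle over $S^{2n+1}$. Let $\pi_n:\mathrm{Spin}(2n+2)\to V_n$, $\pi_n(g)=(ge_0,ge_1)$. An *identification* $V_n\equiv S^{2n+1}\times S^{2n}$ is a Borel isomorphism $\Phi:V_n\to S^{2n+1}\times S^{2n}$ whose first component is $(u,v)\mapsto u$ and which is isometric from each fibre $\{v\in S^{2n+1}: v\perp u\}$ onto $S^{2n}$. For poles $a\in S^{2n+1}$, $b\in S^{2n}$ the *bi-equator* is $$S_n=S_n(a,b)=\{(x,y)\in S^{2n+1}\times S^{2n}:\langle a,x\rangle=0,\ \langle b,y\rangle=0\},$$ and its preimage is $\Sigma_n=(\Phi\circ\pi_n)^{-1}(S_n)\subset \mathrm{Spin}(2n+2)$. **Proposition.** 1. For every $n\ge1$,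 the standard map $\mathrm{Spin}(2n)\to\mathrm{Spin}(2n+2)$ (induced by the inclusion of the last $2n$ coordinates) is a topological embedding; $\pi_n$ induces a homeomorphism $\mathrm{Spin}(2n+2)/\mathrm{Spin}(2n)\cong V_n$; $\pi_n$ is a locally trivial fibre bundle with fibre $\mathrm{Spin}(2n)$; and there is an identification $\Phi$ of $V_n$ with $S^{2n+1}\times S^{2n}$ which, for some point $c\in S^{2n+1}$, is a homeomorphism off the fibres over $c$. 2. For all $a,b$ the bi-equator $S_n(a,b)$ is homeomorphic to $S^{2n}\times S^{2n-1}$ (so it has codimension two in $S^{2n+1}\times S^{2n}$). 3. For every $n$ there is exactly one left-invariant Borel probability measure $\mu_n$ on $\mathrm{Spin}(2n+2)$. 4. As $n\to\infty$, $\mu_n$ concentrates on $\Sigma_n$: for any choice of identifications $\Phi_n$ and poles $a_n\in S^{2n+1}$, $b_n\in S^{2n}$, and for every $\varepsilon>0$, $$\mu_n\big(\mathrm{Spin}(2n+2)\setminus(\Phi_n\circ\pi_n)^{-1}(N_\varepsilon(S_n))\big)\to0\quad\text{and}\quad \mu_n\big(\mathrm{Spin}(2n+2)\setminus N_\varepsilon(\Sigma_n)\big)\to0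 .$$ Here $N_\varepsilon(S_n)$ is the open $\varepsilon$-neighbourhood in $S^{2n+1}\times S^{2n}$ for the maximum of the two Euclidean (chordal) distances of the unit spheres, and $N_\varepsilon(\Sigma_n)$ is the open tubular neighbourhood of radius $\varepsilon$, i.e. the set of points joined to $\Sigma_n$ by a $C^1$ path of length less than $\varepsilon$, for the bi-invariant Riemannian metric on $\mathrm{Spin}(2n+2)$ pulled back from $\langle A,B\rangle=\tfrac12\mathrm{tr}(A^{T}B)$ on $SO(2n+2)$. -/

import Mathlib

open Set Filter Topology MeasureTheory
open scoped RealInnerProductSpace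

/-- Euclidean space `ℝ^m`. -/
abbrev E (m : ℕ) : Type := EuclideanSpace ℝ (Fin m)

/-- The unit sphere of `ℝ^m`, of dimension `m - 1`. -/
abbrev USphere (m : ℕ) : Type := Metric.sphere (0 : E m) 1

/-- The quadratic form `x ↦ ‖x‖ ^ 2` on `ℝ^m`. -/
noncomputable def normForm (m : ℕ) : QuadraticForm ℝ (E m) :=
  LinearMap.BilinMap.toQuadraticMap (innerₗ (E m))

theorem normForm_apply (m : ℕ) (x : E m) : normForm m x = ‖x‖ ^ 2 := by
  simp [normForm]

/-- The real Clifford algebra of `ℝ^m`, with its topology as a finite-dimensional real vector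
space. -/
noncomputable instance instTopologicalSpaceCliffordNormForm (m : ℕ) :
    TopologicalSpace (CliffordAlgebra (normForm m)) :=
  moduleTopology ℝ _

/-- The group `Spin(m)`, with the topology induced from the Clifford algebra: the even
elements `g` with `star g * g = 1` that are products of invertible vectors. -/
abbrev Spin (m : ℕ) : Type := spinGroup (normForm m)

noncomputable instance instMeasurableSpaceSpin (m : ℕ) : MeasurableSpace (Spin m) :=
  borel _

instance instBorelSpaceSpin (m : ℕ) : BorelSpace (Spin m) := ⟨rfl⟩

theorem cliffordι_injective (m : ℕ) :
    Function.Injective (CliffordAlgebra.ι (normForm m)) := by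
  intro x y h
  have h' := congrArg (CliffordAlgebra.equivExterior (normForm m)) h
  simp only [CliffordAlgebra.equivExterior, CliffordAlgebra.changeFormEquiv_apply,
    CliffordAlgebra.changeForm_ι] at h'
  exact ExteriorAlgebra.ι_inj ℝ x y |>.1 h'

theorem clifford_algebraMap_injective (m : ℕ) :
    Function.Injective (algebraMap ℝ (CliffordAlgebra (normForm m))) := by
  intro x y h
  have h' := congrArg (CliffordAlgebra.equivExterior (normForm m)) h
  simp only [CliffordAlgebra.equivExterior, CliffordAlgebra.changeFormEquiv_apply,
    CliffordAlgebra.changeForm_algebraMap] at h'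
  exact (ExteriorAlgebra.algebraMap_leftInverse (R := ℝ) (E m)).injective h'

theorem exists_spin_conj {m : ℕ} (g : Spin m) (x : E m) :
    ∃ y : E m, CliffordAlgebra.ι (normForm m) y =
      (g : CliffordAlgebra (normForm m)) * CliffordAlgebra.ι (normForm m) x *
        ((g⁻¹ : Spin m) : CliffordAlgebra (normForm m)) := by
  have h := spinGroup.conjAct_smul_ι_mem_range_ι (x := spinGroup.toUnits g) g.2 x
  rw [ConjAct.units_smul_def] at h
  exact h

/-- The rotation of `ℝ^m` induced by `g ∈ Spin(m)`, as a map: the double cover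
`Spin(m) → SO(m)`, `x ↦ g x g⁻¹`. -/
noncomputable def spinRotFun {m : ℕ} (g : Spin m) (x : E m) : E m :=
  Classical.choose (exists_spin_conj g x)

theorem ι_spinRotFun {m : ℕ} (g : Spin m) (x : E m) :
    CliffordAlgebra.ι (normForm m) (spinRotFun g x) =
      (g : CliffordAlgebra (normForm m)) * CliffordAlgebra.ι (normForm m) x *
        ((g⁻¹ : Spin m) : CliffordAlgebra (normForm m)) :=
  Classical.choose_spec (exists_spin_conj g x)

/-- The rotation `x ↦ g x g⁻¹` of `ℝ^m` induced by `g ∈ Spin(m)`. -/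
noncomputable def spinRot {m : ℕ} (g : Spin m) : E m →ₗᵢ[ℝ] E m where
  toFun := spinRotFun g
  map_add' x y := cliffordι_injective m (by
    simp only [map_add, ι_spinRotFun, mul_add, add_mul])
  map_smul' c x := cliffordι_injective m (by
    simp only [map_smul, ι_spinRotFun, RingHom.id_apply, mul_smul_comm, smul_mul_assoc])
  norm_map' x := by
    have hg : ((g⁻¹ : Spin m) : CliffordAlgebra (normForm m)) * g = 1 :=
      congrArg Subtype.val (inv_mul_cancel g)
    have hg' : (g : CliffordAlgebra (normForm m)) * ((g⁻¹ : Spin m) : _) = 1 :=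
      congrArg Subtype.val (mul_inv_cancel g)
    have h : normForm m (spinRotFun g x) = normForm m x := by
      apply clifford_algebraMap_injective m
      rw [← CliffordAlgebra.ι_sq_scalar, ι_spinRotFun]
      calc _ = (g : CliffordAlgebra (normForm m)) * CliffordAlgebra.ι (normForm m) x *
              (((g⁻¹ : Spin m) : CliffordAlgebra (normForm m)) * g) *
              CliffordAlgebra.ι (normForm m) x * ((g⁻¹ : Spin m) : _) := by
            simp only [mul_assoc]
        _ = (g : CliffordAlgebra (normForm m)) * (CliffordAlgebra.ι (normForm m) x *
              CliffordAlgebra.ι (normForm m) x) * ((g⁻¹ : Spin m) : _) := by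
            rw [hg, mul_one]; simp only [mul_assoc]
        _ = _ := by
            rw [CliffordAlgebra.ι_sq_scalar, ← Algebra.commutes, mul_assoc, hg', mul_one]
    rw [normForm_apply, normForm_apply] at h
    exact (sq_eq_sq₀ (norm_nonneg _) (norm_nonneg _)).1 h

/-- The inclusion `ℝ^m → ℝ^(m+2)` as the last `m` coordinates. -/
noncomputable def lastCoords (m : ℕ) : normForm m →qᵢ normForm (m + 2) where
  toFun x := WithLp.toLp 2 (Fin.cons 0 (Fin.cons 0 x))
  map_add' x y := by
    ext i
    refine Fin.cases ?_ (fun i => Fin.cases ?_ (fun i => ?_) i) i <;> simp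
  map_smul' c x := by
    ext i
    refine Fin.cases ?_ (fun i => Fin.cases ?_ (fun i => ?_) i) i <;> simp
  map_app' x := by
    simp [normForm_apply, EuclideanSpace.norm_sq_eq, Fin.sum_univ_succ]

theorem clifford_map_star {m k : ℕ} (f : normForm m →qᵢ normForm k)
    (x : CliffordAlgebra (normForm m)) :
    CliffordAlgebra.map f (star x) = star (CliffordAlgebra.map f x) := by
  induction x using CliffordAlgebra.induction with
  | algebraMap r => simp [CliffordAlgebra.star_algebraMap]
  | ι v => simp [CliffordAlgebra.star_ι]
  | mul a b ha hb => simp [star_mul, ha, hb]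
  | add a b ha hb => simp [star_add, ha, hb]

theorem clifford_map_mem_even {m k : ℕ} (f : normForm m →qᵢ normForm k)
    {x : CliffordAlgebra (normForm m)} (hx : x ∈ CliffordAlgebra.even (normForm m)) :
    CliffordAlgebra.map f x ∈ CliffordAlgebra.even (normForm k) := by
  refine CliffordAlgebra.even_induction (normForm m)
    (motive := fun x _ => CliffordAlgebra.map f x ∈ CliffordAlgebra.even (normForm k))
    ?_ ?_ ?_ x hx
  · intro r
    rw [AlgHom.commutes]
    exact Subalgebra.algebraMap_mem _ r
  · intro x y _ _ h₁ h₂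
    rw [map_add]
    exact add_mem h₁ h₂
  · intro a b x _ h
    rw [map_mul, map_mul, CliffordAlgebra.map_apply_ι, CliffordAlgebra.map_apply_ι]
    exact mul_mem (CliffordAlgebra.ι_mul_ι_mem_evenOdd_zero _ _ _) h

theorem clifford_map_mem_spinGroup {m k : ℕ} (f : normForm m →qᵢ normForm k)
    {x : CliffordAlgebra (normForm m)} (hx : x ∈ spinGroup (normForm m)) :
    CliffordAlgebra.map f x ∈ spinGroup (normForm k) := by
  obtain ⟨⟨⟨u, hu, rfl⟩, h₁, h₂⟩, hev⟩ := hx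
  refine ⟨⟨⟨Units.map (CliffordAlgebra.map f : _ →* _) u, ?_, rfl⟩, ?_, ?_⟩,
    clifford_map_mem_even f hev⟩
  · have hle : lipschitzGroup (normForm m) ≤
        (lipschitzGroup (normForm k)).comap (Units.map (CliffordAlgebra.map f : _ →* _)) := by
      refine (Subgroup.closure_le _).2 ?_
      rintro w ⟨v, hv⟩
      refine Subgroup.subset_closure ⟨f v, ?_⟩
      rw [← CliffordAlgebra.map_apply_ι, hv]
      rfl
    exact hle hu
  · rw [← clifford_map_star, ← map_mul, h₁, map_one]
  · rw [← clifford_map_star, ← map_mul, h₂, map_one]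

/-- The standard inclusion `Spin(m) → Spin(m + 2)`, induced by `lastCoords`. -/
noncomputable def spinIncl (m : ℕ) : Spin m →* Spin (m + 2) where
  toFun g := ⟨CliffordAlgebra.map (lastCoords m) g, clifford_map_mem_spinGroup _ g.2⟩
  map_one' := Subtype.ext (map_one _)
  map_mul' _ _ := Subtype.ext (map_mul _ _ _)

/-- The manifold of orthonormal `2`-frames `(u, v)` of `ℝ^(m+2)`, that is, the unit tangent
bundle of the sphere `S^(m+1)`, with bundle projection `(u, v) ↦ u` and fibre `S^m`. -/
abbrev TwoFrames (m : ℕ) : Type :=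
  {p : USphere (m + 2) × USphere (m + 2) // ⟪(p.1 : E (m + 2)), (p.2 : E (m + 2))⟫ = 0}

/-- The `i`-th standard basis vector, as a point of the unit sphere. -/
noncomputable def basisPt {m : ℕ} (i : Fin m) : USphere m :=
  ⟨EuclideanSpace.single i 1, by simp⟩

/-- The action of `Spin(m)` on the unit sphere of `ℝ^m` by rotations. -/
noncomputable def spinAct {m : ℕ} (g : Spin m) (x : USphere m) : USphere m :=
  ⟨spinRot g x, by simp⟩

/-- The orbit map `g ↦ (g e₀, g e₁)` from `Spin(m + 2)` to the orthonormal `2`-frames. -/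
noncomputable def spinFrame (m : ℕ) (g : Spin (m + 2)) : TwoFrames m :=
  ⟨(spinAct g (basisPt 0), spinAct g (basisPt 1)), by
    simp [spinAct, basisPt, (spinRot g).inner_map_map, EuclideanSpace.inner_single_left]⟩

/-- A (Borel) identification of the sphere bundle `TwoFrames m → S^(m+1)` with the product
`S^(m+1) × S^m`: a Borel isomorphism over `S^(m+1)` that is isometric on each fibre. -/
structure ProductIdentification (m : ℕ) where
  toMeasurableEquiv : TwoFrames m ≃ᵐ USphere (m + 2) × USphere (m + 1)
  fst_eq : ∀ p : TwoFrames m, (toMeasurableEquiv p).1 = p.1.1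
  isometry_fibre : ∀ p q : TwoFrames m, p.1.1 = q.1.1 →
    dist (toMeasurableEquiv p).2 (toMeasurableEquiv q).2 = dist p.1.2 q.1.2

/-- The equator of the unit sphere with respect to the pole `a`. -/
def equator {m : ℕ} (a : USphere m) : Set (USphere m) :=
  {x | ⟪(a : E m), (x : E m)⟫ = 0}

/-- The bi-equator of `S^(m+1) × S^m` with respect to the poles `a`, `b`. -/
def biEquator {m : ℕ} (a : USphere (m + 2)) (b : USphere (m + 1)) :
    Set (USphere (m + 2) × USphere (m + 1)) :=
  equator a ×ˢ equator b

/-- The projection `Spin(m + 2) → S^(m+1) × S^m` given by an identification of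
`TwoFrames m` with the product. -/
noncomputable def spinProj {m : ℕ} (Φ : ProductIdentification m) (g : Spin (m + 2)) :
    USphere (m + 2) × USphere (m + 1) :=
  Φ.toMeasurableEquiv (spinFrame m g)

/-- The preimage in `Spin(m + 2)` of the bi-equator. -/
def biEquatorPreimage {m : ℕ} (Φ : ProductIdentification m) (a : USphere (m + 2))
    (b : USphere (m + 1)) : Set (Spin (m + 2)) :=
  spinProj Φ ⁻¹' biEquator a b

/-- A path in `Spin(m)` that is `C¹`: as `Spin(m) → SO(m)` is a covering, this means that it is
continuous and that its image in `SO(m)` is `C¹`. -/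
def IsC1Path {m : ℕ} (γ : ℝ → Spin m) : Prop :=
  Continuous γ ∧ ∀ i : Fin m, ContDiff ℝ 1 fun t => spinRot (γ t) (EuclideanSpace.single i 1)

/-- The length of `γ` on `[0, 1]` in the bi-invariant Riemannian metric of `Spin(m)` that is
the pull-back of the metric `⟨A, B⟩ = tr (Aᵀ B) / 2` of `SO(m)` (with this normalization the
quotient `SO(m) / SO(m - 1)` is the round unit sphere). -/
noncomputable def pathLength {m : ℕ} (γ : ℝ → Spin m) : ℝ :=
  ∫ t in (0 : ℝ)..1,
    √((∑ i : Fin m, ‖deriv (fun s => spinRot (γ s) (EuclideanSpace.single i 1)) t‖ ^ 2) / 2)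

/-- The open tubular neighbourhood of radius `ε` of `A ⊆ Spin(m)` in the bi-invariant
Riemannian metric: the points joined to a point of `A` by a `C¹` path of length `< ε`. -/
def spinTube {m : ℕ} (ε : ℝ) (A : Set (Spin m)) : Set (Spin m) :=
  {g | ∃ γ : ℝ → Spin m, IsC1Path γ ∧ γ 0 ∈ A ∧ γ 1 = g ∧ pathLength γ < ε}

/-! Concentration is a second-moment estimate. Let `g` be Haar distributed on Spin(m+2) and let `F`
be a measurable vector field on the sphere with `‖F‖ ≤ 1`. Right translation by elements that fix
`e₀` and carry `e₁` to `eᵢ` shows that `⟪F (g e₀), g eᵢ⟫ ^ 2` has the same mean for every `i ≥ 1`.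
By Parseval these squares sum to at most 1, so each mean is at most `1 / (m + 1)`
(`lintegral_inner_spinRot_sq_le`), and Chebyshev's inequality makes the inner product small with
high probability. Only measurability of `F` enters, which is why an arbitrary Borel identification
is allowed.

Write `u = g e₀` and `v = g e₁`. The height of the first coordinate over its equator is `⟪a, u⟫`.
Since `Φ` is isometric on fibres, the height of the second is `⟪F u, v⟫`, where `F u` is the vector
of the fibre over `u` that `Φ` sends to `b`. Both heights are small, so the point is close to the
bi-equator.

For the tube, the fibre pole may jump with `u`, so the field must be changed. First `u` is rotated
onto the equator of `a`, to a point `x`; then `v` is rotated inside the fibre over `x` until it is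
orthogonal to the pole `β` of that fibre. The second angle is governed by the inner product of `β`
with the rotated `v`, that is, of `v` with `β` carried back over `u`. This carried pole is again a
measurable field of norm at most 1 (`carriedPole`), and the estimate applies. The two rotations lift
to an explicit path of length at most `√(2 (θ² + φ²))` (`mem_spinTube_of_small`).

The statements on the bundle rest on the kernel of Spin → SO being `{1, -1}`. An element inducing
the trivial rotation is twisted central, hence scalar (`exists_algebraMap_of_twisted_comm`). With
the Cartan–Dieudonné theorem, every element is a product of boundedly many unit vectors, which gives
compactness and the stabilizer of a frame. Local sections come from explicit rotations. -/

open scoped ENNReal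

/-! ### Topology of the Clifford algebra and of the spin group -/

section CliffordTopology

variable (m : ℕ)

/-- The Clifford algebra of `ℝ^m` is finite-dimensional. -/
instance instModuleFiniteCliffordNormForm : Module.Finite ℝ (CliffordAlgebra (normForm m)) :=
  have : Module.Finite ℝ (ExteriorAlgebra ℝ (E m)) :=
    Module.Finite.of_basis (EuclideanSpace.basisFun (Fin m) ℝ).toBasis.ExteriorAlgebra
  Module.Finite.equiv (CliffordAlgebra.equivExterior (normForm m)).symm

instance instIsModuleTopologyCliffordNormForm :
    IsModuleTopology ℝ (CliffordAlgebra (normForm m)) := ⟨rfl⟩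

instance instIsTopologicalRingCliffordNormForm :
    IsTopologicalRing (CliffordAlgebra (normForm m)) :=
  IsModuleTopology.isTopologicalRing ℝ _

instance instT2SpaceCliffordNormForm : T2Space (CliffordAlgebra (normForm m)) := by
  let b := Module.finBasis ℝ (CliffordAlgebra (normForm m))
  exact T2Space.of_injective_continuous b.equivFun.injective
    (IsModuleTopology.continuous_of_linearMap b.equivFun.toLinearMap)

theorem continuous_clifford_linearMap {m : ℕ} {F : Type*} [AddCommGroup F] [Module ℝ F]
    [TopologicalSpace F] [ContinuousAdd F] [ContinuousSMul ℝ F]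
    (f : CliffordAlgebra (normForm m) →ₗ[ℝ] F) : Continuous f :=
  IsModuleTopology.continuous_of_linearMap f

theorem continuous_cliffordι : Continuous (CliffordAlgebra.ι (normForm m)) :=
  LinearMap.continuous_of_finiteDimensional _

theorem continuous_clifford_star : Continuous (star : CliffordAlgebra (normForm m) → _) :=
  continuous_clifford_linearMap (CliffordAlgebra.reverse.comp
    (CliffordAlgebra.involute (Q := normForm m)).toLinearMap)

end CliffordTopology

instance instIsTopologicalGroupSpin (m : ℕ) : IsTopologicalGroup (Spin m) where
  continuous_mul := by
    refine Continuous.subtype_mk ?_ _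
    exact (continuous_subtype_val.comp continuous_fst).mul (continuous_subtype_val.comp continuous_snd)
  continuous_inv :=
    Continuous.subtype_mk ((continuous_clifford_star m).comp continuous_subtype_val) _

/-! ### The twisted centre of the Clifford algebra -/

section TwistedCenter

open CliffordAlgebra

variable {m : ℕ}

theorem cliffordι_mul_ι_add_swap (v w : E m) :
    ι (normForm m) v * ι (normForm m) w + ι (normForm m) w * ι (normForm m) v =
      algebraMap ℝ _ (2 * ⟪v, w⟫) := by
  rw [ι_mul_ι_add_swap]
  congr 1
  simp only [QuadraticMap.polar, normForm_apply, @norm_add_sq ℝ]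
  simp only [RCLike.re_to_real]
  ring

theorem cliffordι_mul_self_of_norm_eq_one {v : E m} (hv : ‖v‖ = 1) :
    ι (normForm m) v * ι (normForm m) v = 1 := by
  rw [ι_sq_scalar, normForm_apply, hv, one_pow, map_one]

/-- In exterior terms, left multiplication by `v` is wedge plus contraction and twisted right
multiplication is wedge minus contraction. The twisted commutator is therefore twice the
contraction. -/
theorem ι_mul_sub_involute_mul_ι (v : E m) (x : CliffordAlgebra (normForm m)) :
    ι (normForm m) v * x - involute x * ι (normForm m) v =
      (2 : ℝ) • contractLeft (innerₗ (E m) v) x := by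
  induction x using CliffordAlgebra.left_induction with
  | algebraMap r => simp [Algebra.commutes]
  | add x y hx hy =>
    simp only [map_add, mul_add, add_mul, smul_add, ← hx, ← hy]
    abel
  | ι_mul x w hx =>
    rw [contractLeft_ι_mul, smul_sub, ← mul_smul_comm, ← hx,
      map_mul, involute_ι, ← mul_assoc, eq_sub_of_add_eq (cliffordι_mul_ι_add_swap v w),
      Algebra.algebraMap_eq_smul_one, innerₗ_apply_apply, smul_smul]
    simp only [sub_mul, mul_sub, smul_mul_assoc, one_mul, mul_assoc, neg_mul]
    abel

/-- The degree operator of the exterior algebra, written with wedge products and contractions. -/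
theorem sum_ι_mul_contractLeft_of_mem {n : ℕ} {x : ExteriorAlgebra ℝ (E m)}
    (hx : x ∈ ⋀[ℝ]^n (E m)) :
    ∑ i, ι (0 : QuadraticForm ℝ (E m)) (EuclideanSpace.single i 1) *
      contractLeft (innerₗ (E m) (EuclideanSpace.single i 1)) x = (n : ℝ) • x := by
  induction hx using Submodule.pow_induction_on_left' with
  | algebraMap r => simp
  | add x y i hx hy ihx ihy => simp only [map_add, mul_add, Finset.sum_add_distrib, ihx, ihy, smul_add]
  | mem_mul w hw i x hx ih =>
    obtain ⟨v, rfl⟩ := hw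
    -- Anticommutation pulls the new factor `v` to the front; the terms `⟪eᵢ, v⟫ eᵢ` sum to `v` and
    -- raise the degree count by one.
    have hswap (a b : E m) (y : ExteriorAlgebra ℝ (E m)) : ι (0 : QuadraticForm ℝ (E m)) a *
        (ι (0 : QuadraticForm ℝ (E m)) b * y) = -(ι (0 : QuadraticForm ℝ (E m)) b *
        (ι (0 : QuadraticForm ℝ (E m)) a * y)) := by
      rw [← mul_assoc, ← mul_assoc, ← neg_mul]
      congr 1
      rw [eq_neg_iff_add_eq_zero]
      exact ExteriorAlgebra.ι_add_mul_swap a b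
    change ∑ i, ι (0 : QuadraticForm ℝ (E m)) (EuclideanSpace.single i 1) *
      contractLeft (innerₗ (E m) (EuclideanSpace.single i 1)) (ι 0 v * x) = _ • (ι 0 v * x)
    simp only [contractLeft_ι_mul, mul_sub, hswap _ v, sub_neg_eq_add, Finset.sum_add_distrib]
    rw [← Finset.mul_sum, ih]
    have : ∑ i, ι (0 : QuadraticForm ℝ (E m)) (EuclideanSpace.single i 1) *
        (innerₗ (E m) (EuclideanSpace.single i 1)) v • x = ι 0 v * x := by
      simp only [mul_smul_comm, ← smul_mul_assoc, ← map_smul, ← Finset.sum_mul, ← map_sum]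
      congr 2
      simpa [EuclideanSpace.inner_single_left] using
        (EuclideanSpace.basisFun (Fin m) ℝ).sum_repr v
    rw [this, mul_smul_comm]
    push_cast
    module

/-- The degree operator `L` is built from contractions, so it kills `x`; it multiplies the component
of degree `n` by `n`, so only degree 0 survives. -/
theorem exists_algebraMap_of_contractLeft_eq_zero (x : ExteriorAlgebra ℝ (E m))
    (hx : ∀ v : E m, contractLeft (Q := (0 : QuadraticForm ℝ (E m))) (innerₗ (E m) v) x = 0) :
    ∃ r : ℝ, x = algebraMap ℝ _ r := by
  classical
  let L : ExteriorAlgebra ℝ (E m) →ₗ[ℝ] ExteriorAlgebra ℝ (E m) :=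
    ∑ i, (LinearMap.mulLeft ℝ (ι (0 : QuadraticForm ℝ (E m)) (EuclideanSpace.single i 1))).comp
      (contractLeft (innerₗ (E m) (EuclideanSpace.single i 1)))
  have hL {n : ℕ} {y : ExteriorAlgebra ℝ (E m)} (hy : y ∈ ⋀[ℝ]^n (E m)) : L y = (n : ℝ) • y := by
    rw [← sum_ι_mul_contractLeft_of_mem hy]
    simp [L]
  have key (y : ExteriorAlgebra ℝ (E m)) (n : ℕ) :
      (DirectSum.decompose (fun n ↦ ⋀[ℝ]^n (E m)) (L y) n : ExteriorAlgebra ℝ (E m)) =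
        (n : ℝ) • (DirectSum.decompose (fun n ↦ ⋀[ℝ]^n (E m)) y n : ExteriorAlgebra ℝ (E m)) := by
    induction y using DirectSum.Decomposition.inductionOn (fun n ↦ ⋀[ℝ]^n (E m)) with
    | zero => simp
    | add a b ha hb => simp [ha, hb, smul_add]
    | @homogeneous i y =>
      rw [hL y.2, DirectSum.decompose_smul, DirectSum.smul_apply, Submodule.coe_smul]
      by_cases h : i = n
      · subst h; rfl
      · rw [DirectSum.decompose_coe, DirectSum.of_eq_of_ne _ _ _ (Ne.symm h)]
        simp
  have hL0 : L x = 0 := by simp [L, hx]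
  have hn (n : ℕ) (hn : n ≠ 0) :
      (DirectSum.decompose (fun n ↦ ⋀[ℝ]^n (E m)) x n : ExteriorAlgebra ℝ (E m)) = 0 := by
    have := key x n
    rw [hL0] at this
    simpa [hn] using this.symm
  have h0 : x = DirectSum.decompose (fun n ↦ ⋀[ℝ]^n (E m)) x 0 := by
    conv_lhs => rw [← DirectSum.sum_support_decompose (fun n ↦ ⋀[ℝ]^n (E m)) x]
    exact Finset.sum_eq_single 0 (fun n _ h => hn n h) (by simp)
  have hm : x ∈ ⋀[ℝ]^0 (E m) := h0 ▸ (DirectSum.decompose (fun n ↦ ⋀[ℝ]^n (E m)) x 0).2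
  rw [ExteriorAlgebra.exteriorPower, pow_zero, Submodule.mem_one] at hm
  obtain ⟨r, hr⟩ := hm
  exact ⟨r, hr.symm⟩

/-- The twisted centre of the Clifford algebra consists of the scalars. -/
theorem exists_algebraMap_of_twisted_comm (x : CliffordAlgebra (normForm m))
    (hx : ∀ v : E m, ι (normForm m) v * x = involute x * ι (normForm m) v) :
    ∃ r : ℝ, x = algebraMap ℝ _ r := by
  -- The change of form commutes with contractions, which moves the question to the exterior
  -- algebra, where a grading by degree is available.
  obtain ⟨r, hr⟩ := exists_algebraMap_of_contractLeft_eq_zero (equivExterior (normForm m) x)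
    fun v => by
      have := ι_mul_sub_involute_mul_ι v x
      rw [hx, sub_self, eq_comm, smul_eq_zero_iff_right two_ne_zero] at this
      simp only [equivExterior, changeFormEquiv_apply, ← changeForm_contractLeft, this, map_zero]
  refine ⟨r, (equivExterior (normForm m)).injective ?_⟩
  rw [hr]
  simp only [equivExterior, changeFormEquiv_apply, changeForm_algebraMap]

end TwistedCenter

/-! ### Products of unit vectors and of reflections -/

section Reflections

open CliffordAlgebra

variable {m : ℕ}

/-- The reflection of `ℝ^m` in the hyperplane orthogonal to `v` (the identity if `v = 0`). -/
noncomputable abbrev vecRefl (v : E m) : E m ≃ₗᵢ[ℝ] E m := (ℝ ∙ v)ᗮ.reflection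

theorem vecRefl_apply (v x : E m) : vecRefl v x = x - (2 * (⟪v, x⟫ / ‖v‖ ^ 2)) • v := by
  rw [vecRefl, Submodule.reflection_orthogonal_apply, Submodule.reflection_singleton_apply]
  simp only [RCLike.ofReal_real_eq_id, id_eq]
  module

theorem vecRefl_apply_of_norm_eq_one {v : E m} (hv : ‖v‖ = 1) (x : E m) :
    vecRefl v x = x - (2 * ⟪v, x⟫) • v := by
  rw [vecRefl_apply, hv, one_pow, div_one]

theorem vecRefl_vecRefl (v x : E m) : vecRefl v (vecRefl v x) = x :=
  Submodule.reflection_reflection _ x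

theorem vecRefl_of_inner_eq_zero {v x : E m} (h : ⟪v, x⟫ = 0) : vecRefl v x = x := by
  simp [vecRefl_apply, h]

theorem vecRefl_self (v : E m) : vecRefl v v = -v := by
  rw [vecRefl_apply, real_inner_self_eq_norm_sq]
  rcases eq_or_ne v 0 with rfl | hv
  · simp
  · rw [div_self (by simpa using hv)]
    module

theorem vecRefl_sub {u v : E m} (h : ‖u‖ = ‖v‖) : vecRefl (u - v) u = v :=
  Submodule.reflection_sub h

/-- Conjugation by a unit vector is minus the reflection; the signs cancel in products of even
length. -/
theorem ι_mul_ι_of_norm_eq_one {v : E m} (hv : ‖v‖ = 1) (x : E m) :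
    ι (normForm m) v * ι (normForm m) x =
      -(ι (normForm m) (vecRefl v x) * ι (normForm m) v) := by
  rw [vecRefl_apply_of_norm_eq_one hv, map_sub, sub_mul, map_smul, smul_mul_assoc,
    cliffordι_mul_self_of_norm_eq_one hv, ← Algebra.algebraMap_eq_smul_one, neg_sub,
    ← cliffordι_mul_ι_add_swap]
  abel

/-- The product in the Clifford algebra of a list of vectors. -/
noncomputable def vecProd (l : List (E m)) : CliffordAlgebra (normForm m) :=
  (l.map (ι (normForm m))).prod

@[simp] theorem vecProd_nil : vecProd ([] : List (E m)) = 1 := rfl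

@[simp] theorem vecProd_cons (v : E m) (l : List (E m)) :
    vecProd (v :: l) = ι (normForm m) v * vecProd l := by simp [vecProd]

@[simp] theorem vecProd_append (l l' : List (E m)) :
    vecProd (l ++ l') = vecProd l * vecProd l' := by simp [vecProd]

/-- The composition of the reflections in a list of vectors. -/
noncomputable def reflProd (l : List (E m)) : E m ≃ₗᵢ[ℝ] E m := (l.map vecRefl).prod

@[simp] theorem reflProd_nil (x : E m) : reflProd [] x = x := rfl

@[simp] theorem reflProd_cons (v : E m) (l : List (E m)) (x : E m) :
    reflProd (v :: l) x = vecRefl v (reflProd l x) := by simp [reflProd]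

theorem involute_vecProd (l : List (E m)) :
    involute (vecProd l) = (-1 : ℝ) ^ l.length • vecProd l := by
  induction l with
  | nil => simp
  | cons v l ih => simp [ih, pow_succ]

theorem star_vecProd (l : List (E m)) :
    star (vecProd l) = (-1 : ℝ) ^ l.length • vecProd l.reverse := by
  induction l with
  | nil => simp
  | cons v l ih => simp [ih, pow_succ, star_mul, CliffordAlgebra.star_ι]

theorem vecProd_mul_vecProd_reverse {l : List (E m)} (hl : ∀ v ∈ l, ‖v‖ = 1) :
    vecProd l * vecProd l.reverse = 1 := by
  induction l with
  | nil => simp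
  | cons v l ih =>
    simp only [List.mem_cons, forall_eq_or_imp] at hl
    simp only [vecProd_cons, List.reverse_cons, vecProd_append, vecProd_nil, mul_one]
    rw [mul_assoc, ← mul_assoc (vecProd l), ih hl.2, one_mul,
      cliffordι_mul_self_of_norm_eq_one hl.1]

theorem vecProd_reverse_mul_vecProd {l : List (E m)} (hl : ∀ v ∈ l, ‖v‖ = 1) :
    vecProd l.reverse * vecProd l = 1 := by
  simpa using vecProd_mul_vecProd_reverse (l := l.reverse) (by simpa using hl)

theorem vecProd_mul_ι {l : List (E m)} (hl : ∀ v ∈ l, ‖v‖ = 1) (x : E m) :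
    vecProd l * ι (normForm m) x =
      (-1 : ℝ) ^ l.length • (ι (normForm m) (reflProd l x) * vecProd l) := by
  induction l with
  | nil => simp
  | cons v l ih =>
    simp only [List.mem_cons, forall_eq_or_imp] at hl
    rw [vecProd_cons, mul_assoc, ih hl.2, mul_smul_comm, ← mul_assoc,
      ι_mul_ι_of_norm_eq_one hl.1, reflProd_cons, List.length_cons, pow_succ]
    simp [mul_assoc]

/-- Cartan–Dieudonné, normalised: zero vectors give trivial reflections and are dropped, and the
others are rescaled, since a reflection depends only on the line. -/
theorem exists_reflProd_eq (φ : E m ≃ₗᵢ[ℝ] E m) :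
    ∃ l : List (E m), (∀ v ∈ l, ‖v‖ = 1) ∧ l.length ≤ m ∧ ∀ x, reflProd l x = φ x := by
  obtain ⟨l, hl, h⟩ := φ.reflections_generate_dim
  rw [finrank_euclideanSpace_fin] at hl
  suffices H : ∀ l : List (E m), ∃ l' : List (E m), (∀ v ∈ l', ‖v‖ = 1) ∧
      l'.length ≤ l.length ∧ ∀ x, reflProd l' x = reflProd l x by
    obtain ⟨l', h₁, h₂, h₃⟩ := H l
    exact ⟨l', h₁, h₂.trans hl, fun x => by rw [h₃, h]; rfl⟩
  intro l
  induction l with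
  | nil => exact ⟨[], by simp⟩
  | cons v l ih =>
    obtain ⟨l', h₁, h₂, h₃⟩ := ih
    by_cases hv : v = 0
    · exact ⟨l', h₁, h₂.trans (by simp), fun x => by
        rw [h₃, reflProd_cons, hv, vecRefl_of_inner_eq_zero (inner_zero_left _)]⟩
    · refine ⟨(‖v‖⁻¹ • v) :: l', ?_, by simpa using h₂, fun x => ?_⟩
      · simp only [List.mem_cons, forall_eq_or_imp]
        exact ⟨norm_smul_inv_norm hv, h₁⟩
      · have hv' : ‖‖v‖⁻¹ • v‖ = 1 := norm_smul_inv_norm hv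
        rw [reflProd_cons, reflProd_cons, h₃, vecRefl_apply_of_norm_eq_one hv', vecRefl_apply,
          smul_smul, real_inner_smul_left]
        congr 2
        field_simp

end Reflections

/-! ### The rotation action, its kernel, and compactness -/

section SpinRotation

open CliffordAlgebra

variable {m : ℕ}

theorem ι_spinRot (g : Spin m) (x : E m) :
    ι (normForm m) (spinRot g x) = (g : CliffordAlgebra (normForm m)) * ι (normForm m) x *
      star (g : CliffordAlgebra (normForm m)) := ι_spinRotFun g x

theorem spin_mul_ι (g : Spin m) (x : E m) :
    (g : CliffordAlgebra (normForm m)) * ι (normForm m) x =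
      ι (normForm m) (spinRot g x) * (g : CliffordAlgebra (normForm m)) := by
  rw [ι_spinRot, mul_assoc, spinGroup.coe_star_mul_self, mul_one]

theorem spinRot_eq_of_mul_ι {g : Spin m} {x y : E m}
    (h : (g : CliffordAlgebra (normForm m)) * ι (normForm m) x =
      ι (normForm m) y * (g : CliffordAlgebra (normForm m))) : spinRot g x = y := by
  apply cliffordι_injective m
  rw [ι_spinRot, h, mul_assoc, spinGroup.mul_star_self_of_mem g.2, mul_one]

theorem spinRot_one (x : E m) : spinRot (1 : Spin m) x = x :=
  spinRot_eq_of_mul_ι (by simp)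

theorem spinRot_mul (g h : Spin m) (x : E m) : spinRot (g * h) x = spinRot g (spinRot h x) := by
  apply spinRot_eq_of_mul_ι
  rw [Submonoid.coe_mul, mul_assoc, spin_mul_ι, ← mul_assoc, spin_mul_ι, mul_assoc]

theorem spinRot_inv_spinRot (g : Spin m) (x : E m) : spinRot g⁻¹ (spinRot g x) = x := by
  rw [← spinRot_mul, inv_mul_cancel, spinRot_one]

theorem spinRot_spinRot_inv (g : Spin m) (x : E m) : spinRot g (spinRot g⁻¹ x) = x := by
  rw [← spinRot_mul, mul_inv_cancel, spinRot_one]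

/-- The rotation of `ℝ^m` induced by `g ∈ Spin(m)`, as a linear isometric equivalence. -/
noncomputable def spinRotEquiv (g : Spin m) : E m ≃ₗᵢ[ℝ] E m where
  toLinearEquiv := LinearEquiv.ofLinearMap (spinRot g).toLinearMap (spinRot g⁻¹).toLinearMap
    (LinearMap.ext fun x => spinRot_spinRot_inv g x) (LinearMap.ext fun x => spinRot_inv_spinRot g x)
  norm_map' := (spinRot g).norm_map

@[simp] theorem spinRotEquiv_apply (g : Spin m) (x : E m) : spinRotEquiv g x = spinRot g x := rfl

theorem continuous_spinRot : Continuous fun p : Spin m × E m => spinRot p.1 p.2 := by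
  obtain ⟨f, hf⟩ := (ι (normForm m)).exists_leftInverse_of_injective
    (LinearMap.ker_eq_bot.2 (cliffordι_injective m))
  have h (p : Spin m × E m) : spinRot p.1 p.2 =
      f ((p.1 : CliffordAlgebra (normForm m)) * ι (normForm m) p.2 *
        star (p.1 : CliffordAlgebra (normForm m))) := by
    rw [← ι_spinRot]
    exact (LinearMap.congr_fun hf _).symm
  simp only [h]
  refine (continuous_clifford_linearMap f).comp (Continuous.mul (Continuous.mul ?_ ?_) ?_)
  · exact continuous_subtype_val.comp continuous_fst
  · exact (continuous_cliffordι m).comp continuous_snd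
  · exact (continuous_clifford_star m).comp (continuous_subtype_val.comp continuous_fst)

theorem involute_spin (g : Spin m) : involute (g : CliffordAlgebra (normForm m)) = g :=
  spinGroup.involute_eq g.2

/-- An element of `Spin(m)` is determined up to sign by its rotation, which is a product of an
even number of reflections. -/
theorem spin_eq_or_eq_neg_vecProd {g : Spin m} {l : List (E m)} (hl : ∀ v ∈ l, ‖v‖ = 1)
    (h : ∀ x, spinRot g x = reflProd l x) :
    Even l.length ∧ ((g : CliffordAlgebra (normForm m)) = vecProd l ∨
      (g : CliffordAlgebra (normForm m)) = -vecProd l) := by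
  -- The reversed product is the inverse of `vecProd l`, so the two rotations cancel and this
  -- product lies in the twisted centre.
  obtain ⟨c, hc⟩ := exists_algebraMap_of_twisted_comm
    (vecProd l.reverse * (g : CliffordAlgebra (normForm m))) fun v => by
      have h₁ := vecProd_mul_ι hl v
      rw [← h] at h₁
      rw [map_mul, involute_vecProd, involute_spin, List.length_reverse, smul_mul_assoc,
        smul_mul_assoc, mul_assoc, spin_mul_ι]
      calc ι (normForm m) v * (vecProd l.reverse * (g : CliffordAlgebra (normForm m)))
          = vecProd l.reverse * (vecProd l * ι (normForm m) v) * vecProd l.reverse * g := by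
            rw [← mul_assoc (vecProd l.reverse), vecProd_reverse_mul_vecProd hl, one_mul, mul_assoc]
        _ = (-1 : ℝ) ^ l.length • (vecProd l.reverse * (ι (normForm m) (spinRot g v) *
              (vecProd l * vecProd l.reverse) * g)) := by
            rw [h₁]
            simp only [mul_smul_comm, smul_mul_assoc, mul_assoc]
        _ = _ := by rw [vecProd_mul_vecProd_reverse hl, mul_one]
  have hg : (g : CliffordAlgebra (normForm m)) = c • vecProd l := by
    rw [← one_mul (g : CliffordAlgebra (normForm m)), ← vecProd_mul_vecProd_reverse hl, mul_assoc,
      hc, Algebra.algebraMap_eq_smul_one, mul_smul_comm, mul_one]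
  have hstar := spinGroup.coe_star_mul_self g
  have hinv := involute_spin g
  have hone : (1 : CliffordAlgebra (normForm m)) ≠ 0 := one_ne_zero
  -- For odd length the grade involution would negate `g`, but it fixes `g`; then `g = 0`, against
  -- `star g * g = 1`.
  have heven : Even l.length := by
    by_contra hodd
    rw [Nat.not_even_iff_odd] at hodd
    rw [hg, map_smul, involute_vecProd, hodd.neg_one_pow, ← hg, smul_comm, ← hg, neg_smul, one_smul,
      neg_eq_iff_add_eq_zero, ← two_smul ℝ, smul_eq_zero_iff_right two_ne_zero] at hinv
    rw [hinv, mul_zero] at hstar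
    exact hone hstar.symm
  refine ⟨heven, ?_⟩
  have hc2 : c * c = 1 := by
    rw [hg, CliffordAlgebra.star_smul,
      star_vecProd, heven.neg_one_pow, one_smul, smul_mul_assoc, mul_smul_comm,
      vecProd_reverse_mul_vecProd hl, smul_smul, ← Algebra.algebraMap_eq_smul_one] at hstar
    exact clifford_algebraMap_injective m (by rw [hstar, map_one])
  rcases mul_self_eq_one_iff.1 hc2 with rfl | rfl
  · left; rw [hg, one_smul]
  · right; rw [hg, neg_smul, one_smul]

theorem vecProd_pair_mem_spinGroup {u w : E m} (hu : ‖u‖ = 1) (hw : ‖w‖ = 1) :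
    vecProd [u, w] ∈ spinGroup (normForm m) := by
  have hl : ∀ v ∈ [u, w], ‖v‖ = 1 := by simp [hu, hw]
  have hu' := cliffordι_mul_self_of_norm_eq_one hu
  have hw' := cliffordι_mul_self_of_norm_eq_one hw
  refine ⟨⟨⟨⟨ι _ u, ι _ u, hu', hu'⟩ * ⟨ι _ w, ι _ w, hw', hw'⟩, ?_, ?_⟩, ?_, ?_⟩, ?_⟩
  · exact mul_mem (Subgroup.subset_closure ⟨u, rfl⟩) (Subgroup.subset_closure ⟨w, rfl⟩)
  · simp
  · rw [star_vecProd]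
    simpa using vecProd_reverse_mul_vecProd hl
  · rw [star_vecProd]
    simpa using vecProd_mul_vecProd_reverse hl
  · rw [vecProd_cons, vecProd_cons, vecProd_nil, mul_one]
    exact ι_mul_ι_mem_evenOdd_zero (normForm m) u w

theorem vecProd_mem_spinGroup : ∀ {l : List (E m)}, (∀ v ∈ l, ‖v‖ = 1) → Even l.length →
    vecProd l ∈ spinGroup (normForm m)
  | [], _, _ => one_mem _
  | [_], _, h => by simp at h
  | u :: w :: l, hl, h => by
    simp only [List.mem_cons, forall_eq_or_imp] at hl
    have : vecProd (u :: w :: l) = vecProd [u, w] * vecProd l := by simp [mul_assoc]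
    rw [this]
    refine mul_mem (vecProd_pair_mem_spinGroup hl.1 hl.2.1) (vecProd_mem_spinGroup hl.2.2 ?_)
    simpa [Nat.even_add_one] using h

/-- As `(-v) v = -1`, a sign is absorbed by two more unit vectors without changing the parity of the
length. -/
theorem neg_vecProd_eq {v : E m} (hv : ‖v‖ = 1) (l : List (E m)) :
    -vecProd l = vecProd (-v :: v :: l) := by
  simp [← mul_assoc, cliffordι_mul_self_of_norm_eq_one hv]

/-- `Spin(m)` consists of the products of an even, bounded number of unit vectors. -/
theorem exists_vecProd_eq (hm : 1 ≤ m) (g : Spin m) :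
    ∃ l : List (E m), (∀ v ∈ l, ‖v‖ = 1) ∧ Even l.length ∧ l.length ≤ m + 2 ∧
      (g : CliffordAlgebra (normForm m)) = vecProd l := by
  obtain ⟨l, hl, hlm, h⟩ := exists_reflProd_eq (spinRotEquiv g)
  obtain ⟨heven, hg | hg⟩ := spin_eq_or_eq_neg_vecProd hl fun x => (h x).symm
  · exact ⟨l, hl, heven, by omega, hg⟩
  -- The sign costs two vectors beyond the `m` of Cartan–Dieudonné, whence the bound `m + 2`.
  · have he : ‖(EuclideanSpace.single (⟨0, hm⟩ : Fin m) 1 : E m)‖ = 1 := by simp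
    refine ⟨-EuclideanSpace.single ⟨0, hm⟩ 1 :: EuclideanSpace.single ⟨0, hm⟩ 1 :: l, ?_, ?_, ?_, ?_⟩
    · simp only [List.mem_cons, forall_eq_or_imp, norm_neg]
      exact ⟨he, he, hl⟩
    · simp [heven]
    · simpa using hlm
    · rw [hg, neg_vecProd_eq he]

/-- Products of exactly `k` unit vectors form a continuous image of a product of spheres; the bound
on the length leaves a finite union. -/
theorem isCompact_spinGroup (hm : 1 ≤ m) :
    IsCompact (spinGroup (normForm m) : Set (CliffordAlgebra (normForm m))) := by
  let K : ℕ → Set (CliffordAlgebra (normForm m)) := fun k =>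
    vecProd '' {l : List (E m) | (∀ v ∈ l, ‖v‖ = 1) ∧ l.length = k}
  have hK : ∀ k, IsCompact (K k) := by
    intro k
    induction k with
    | zero =>
      convert! isCompact_singleton (x := (1 : CliffordAlgebra (normForm m)))
      ext x
      constructor
      · rintro ⟨l, ⟨-, hl⟩, rfl⟩
        rw [List.length_eq_zero_iff.1 hl]; rfl
      · rintro rfl
        exact ⟨[], by simp⟩
    | succ k ih =>
      convert! ((isCompact_sphere (0 : E m) 1).image (continuous_cliffordι m)).mul ih
      ext x
      constructor
      · rintro ⟨_ | ⟨v, l⟩, ⟨hv, hl⟩, rfl⟩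
        · simp at hl
        · simp only [List.mem_cons, forall_eq_or_imp] at hv
          refine ⟨_, ⟨v, by simpa using hv.1, rfl⟩, _, ⟨l, ⟨hv.2, by simpa using hl⟩, rfl⟩, by simp⟩
      · rintro ⟨_, ⟨v, hv, rfl⟩, _, ⟨l, ⟨h, hl⟩, rfl⟩, rfl⟩
        refine ⟨v :: l, ⟨?_, by simpa using hl⟩, by simp⟩
        simp only [List.mem_cons, forall_eq_or_imp]
        exact ⟨by simpa using hv, h⟩
  have : (spinGroup (normForm m) : Set (CliffordAlgebra (normForm m))) =
      ⋃ k ∈ {k | k ≤ m + 2 ∧ Even k}, K k := by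
    ext x
    simp only [mem_iUnion]
    constructor
    · intro hx
      obtain ⟨l, hl, heven, hlm, h⟩ := exists_vecProd_eq hm ⟨x, hx⟩
      exact ⟨l.length, ⟨hlm, heven⟩, l, ⟨hl, rfl⟩, h.symm⟩
    · rintro ⟨k, ⟨-, hk⟩, l, ⟨hl, rfl⟩, rfl⟩
      exact vecProd_mem_spinGroup hl hk
  rw [this]
  exact ((finite_le_nat (m + 2)).subset fun k hk => hk.1).isCompact_biUnion fun k _ => hK k

theorem compactSpace_spin (hm : 1 ≤ m) : CompactSpace (Spin m) :=
  isCompact_iff_compactSpace.1 (isCompact_spinGroup hm)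

/-- The product of two unit vectors, as an element of `Spin(m)`. -/
noncomputable def spinPair (u w : USphere m) : Spin m :=
  ⟨ι (normForm m) u * ι (normForm m) w, by
    simpa using vecProd_pair_mem_spinGroup (norm_eq_of_mem_sphere u) (norm_eq_of_mem_sphere w)⟩

theorem continuous_spinPair : Continuous fun p : USphere m × USphere m => spinPair p.1 p.2 := by
  have h₁ := (continuous_cliffordι m).comp
    (continuous_subtype_val.comp (continuous_fst (X := USphere m) (Y := USphere m)))
  have h₂ := (continuous_cliffordι m).comp
    (continuous_subtype_val.comp (continuous_snd (X := USphere m) (Y := USphere m)))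
  exact (h₁.mul h₂).subtype_mk _

theorem spinRot_spinPair (u w : USphere m) (x : E m) :
    spinRot (spinPair u w) x = vecRefl (u : E m) (vecRefl (w : E m) x) := by
  apply spinRot_eq_of_mul_ι
  simp only [spinPair]
  rw [mul_assoc, ι_mul_ι_of_norm_eq_one (norm_eq_of_mem_sphere w), mul_neg, ← mul_assoc,
    ι_mul_ι_of_norm_eq_one (norm_eq_of_mem_sphere u), neg_mul, neg_neg, mul_assoc]

theorem spinPair_self (u : USphere m) : spinPair u u = 1 :=
  Subtype.ext (cliffordι_mul_self_of_norm_eq_one (norm_eq_of_mem_sphere u))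

end SpinRotation

/-! ### The inclusion of Spin(m) in Spin(m+2) as a stabilizer -/

section Stabilizer

open CliffordAlgebra

variable {m : ℕ}

/-- The inclusion `ℝ^m → ℝ^(m+2)` as the last `m` coordinates, as a linear isometry. -/
noncomputable def lastCoordsₗᵢ (m : ℕ) : E m →ₗᵢ[ℝ] E (m + 2) where
  toLinearMap := (lastCoords m).toLinearMap
  norm_map' x := by
    have := (lastCoords m).map_app x
    rw [normForm_apply, normForm_apply] at this
    exact (sq_eq_sq₀ (norm_nonneg _) (norm_nonneg _)).1 this

@[simp] theorem lastCoordsₗᵢ_apply (x : E m) : lastCoordsₗᵢ m x = lastCoords m x := rfl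

theorem lastCoords_apply_zero (x : E m) : lastCoords m x 0 = 0 := rfl

theorem lastCoords_apply_one (x : E m) : lastCoords m x 1 = 0 := rfl

theorem lastCoords_apply_succ_succ (x : E m) (i : Fin m) :
    lastCoords m x i.succ.succ = x i := rfl

theorem eq_single_add_single_add_lastCoords (y : E (m + 2)) :
    y = y 0 • EuclideanSpace.single 0 1 + y 1 • EuclideanSpace.single 1 1 +
      lastCoords m (WithLp.toLp 2 fun i => y i.succ.succ) := by
  ext i
  refine Fin.cases ?_ (fun i => Fin.cases ?_ (fun i => ?_) i) i
  · simp [lastCoords_apply_zero]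
  · simp [lastCoords_apply_one]
  · simp [lastCoords_apply_succ_succ, Fin.ext_iff]

theorem exists_lastCoords_eq {y : E (m + 2)} (h₀ : ⟪EuclideanSpace.single 0 1, y⟫ = 0)
    (h₁ : ⟪EuclideanSpace.single 1 1, y⟫ = 0) : ∃ x : E m, lastCoords m x = y := by
  have h₀' : y 0 = 0 := by simpa [EuclideanSpace.inner_single_left] using h₀
  have h₁' : y 1 = 0 := by simpa [EuclideanSpace.inner_single_left] using h₁
  refine ⟨WithLp.toLp 2 fun i => y i.succ.succ, ?_⟩
  conv_rhs => rw [eq_single_add_single_add_lastCoords y, h₀', h₁']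
  simp

theorem inner_single_zero_lastCoords (x : E m) :
    ⟪(EuclideanSpace.single 0 1 : E (m + 2)), lastCoords m x⟫ = 0 := by
  simp [EuclideanSpace.inner_single_left, lastCoords_apply_zero]

theorem inner_single_one_lastCoords (x : E m) :
    ⟪(EuclideanSpace.single 1 1 : E (m + 2)), lastCoords m x⟫ = 0 := by
  simp [EuclideanSpace.inner_single_left, lastCoords_apply_one]

theorem reflProd_of_inner_eq_zero {l : List (E m)} {x : E m} (h : ∀ v ∈ l, ⟪v, x⟫ = 0) :
    reflProd l x = x := by
  induction l with
  | nil => rfl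
  | cons v l ih =>
    simp only [List.mem_cons, forall_eq_or_imp] at h
    rw [reflProd_cons, ih h.2, vecRefl_of_inner_eq_zero h.1]

theorem reflProd_map_lastCoords (l : List (E m)) (x : E m) :
    reflProd (l.map (lastCoords m)) (lastCoords m x) = lastCoords m (reflProd l x) := by
  induction l with
  | nil => rfl
  | cons v l ih =>
    rw [List.map_cons, reflProd_cons, ih, reflProd_cons, vecRefl_apply, vecRefl_apply]
    simp only [← lastCoordsₗᵢ_apply, LinearIsometry.inner_map_map, LinearIsometry.norm_map, map_sub,
      map_smul]

theorem map_vecProd (l : List (E m)) :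
    CliffordAlgebra.map (lastCoords m) (vecProd l) = vecProd (l.map (lastCoords m)) := by
  induction l with
  | nil => simp
  | cons v l ih => simp [ih]

theorem norm_lastCoords (x : E m) : ‖lastCoords m x‖ = ‖x‖ := (lastCoordsₗᵢ m).norm_map x

theorem coe_spinIncl (g : Spin m) :
    (spinIncl m g : CliffordAlgebra (normForm (m + 2))) = CliffordAlgebra.map (lastCoords m) g := rfl

theorem spinRot_eq_reflProd {g : Spin m} {l : List (E m)} (hl : ∀ v ∈ l, ‖v‖ = 1)
    (heven : Even l.length) (hg : (g : CliffordAlgebra (normForm m)) = vecProd l) (x : E m) :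
    spinRot g x = reflProd l x := by
  apply spinRot_eq_of_mul_ι
  rw [hg, vecProd_mul_ι hl, heven.neg_one_pow, one_smul]

theorem spinRot_spinIncl_of_inner_eq_zero (hm : 1 ≤ m) (g : Spin m) {y : E (m + 2)}
    (hy : ∀ x, ⟪lastCoords m x, y⟫ = 0) : spinRot (spinIncl m g) y = y := by
  obtain ⟨l, hl, heven, -, hg⟩ := exists_vecProd_eq hm g
  rw [spinRot_eq_reflProd (l := l.map (lastCoords m)) (by simpa [norm_lastCoords] using hl)
    (by simpa using heven) (by rw [coe_spinIncl, hg, map_vecProd])]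
  exact reflProd_of_inner_eq_zero (by simp [hy])

theorem spinRot_spinIncl_single_zero (hm : 1 ≤ m) (g : Spin m) :
    spinRot (spinIncl m g) (EuclideanSpace.single 0 1) = EuclideanSpace.single 0 1 :=
  spinRot_spinIncl_of_inner_eq_zero hm g fun x => by
    rw [real_inner_comm, inner_single_zero_lastCoords]

theorem spinRot_spinIncl_single_one (hm : 1 ≤ m) (g : Spin m) :
    spinRot (spinIncl m g) (EuclideanSpace.single 1 1) = EuclideanSpace.single 1 1 :=
  spinRot_spinIncl_of_inner_eq_zero hm g fun x => by
    rw [real_inner_comm, inner_single_one_lastCoords]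

theorem spinRot_spinIncl_lastCoords (g : Spin m) (x : E m) :
    spinRot (spinIncl m g) (lastCoords m x) = lastCoords m (spinRot g x) := by
  apply spinRot_eq_of_mul_ι
  rw [coe_spinIncl, ← map_apply_ι, ← map_apply_ι, ← map_mul, ← map_mul, spin_mul_ι]

/-- An element of the kernel induces the trivial rotation, so it is `1` or `-1`, and `-1` is sent to
`-1`. -/
theorem spinIncl_injective (m : ℕ) : Function.Injective (spinIncl m) := by
  rw [injective_iff_map_eq_one]
  intro g hg
  have hrot (x : E m) : spinRot g x = x := by
    apply (lastCoordsₗᵢ m).injective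
    simp only [lastCoordsₗᵢ_apply]
    rw [← spinRot_spinIncl_lastCoords, hg, spinRot_one]
  obtain ⟨-, h | h⟩ := spin_eq_or_eq_neg_vecProd (g := g) (l := []) (by simp) hrot
  · exact Subtype.ext h
  · have h' := congrArg Subtype.val hg
    rw [coe_spinIncl, h] at h'
    simp only [vecProd_nil, map_neg, map_one, OneMemClass.coe_one] at h'
    have h2 : (2 : ℝ) • (1 : CliffordAlgebra (normForm (m + 2))) = 0 := by
      rw [two_smul]
      nth_rw 1 [← h']
      exact neg_add_cancel 1
    simp at h2

theorem continuous_spinIncl (m : ℕ) : Continuous (spinIncl m) :=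
  ((continuous_clifford_linearMap (CliffordAlgebra.map (lastCoords m)).toLinearMap).comp
    continuous_subtype_val).subtype_mk _

theorem isEmbedding_spinIncl (hm : 1 ≤ m) : IsEmbedding (spinIncl m) :=
  have := compactSpace_spin hm
  ((continuous_spinIncl m).isClosedEmbedding (spinIncl_injective m)).isEmbedding

/-- The stabilizer of `(e₀, e₁)` in `Spin(m + 2)` is `Spin(m)`. -/
theorem exists_spinIncl_eq (hm : 1 ≤ m) {g : Spin (m + 2)}
    (h₀ : spinRot g (EuclideanSpace.single 0 1) = EuclideanSpace.single 0 1)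
    (h₁ : spinRot g (EuclideanSpace.single 1 1) = EuclideanSpace.single 1 1) :
    ∃ h : Spin m, spinIncl m h = g := by
  -- Fixing `e₀` and `e₁`, the rotation preserves their orthogonal complement and restricts to an
  -- isometry of the last coordinates.
  have hx (x : E m) : ∃ y : E m, lastCoords m y = spinRot g (lastCoords m x) := by
    apply exists_lastCoords_eq
    · rw [← h₀, LinearIsometry.inner_map_map, inner_single_zero_lastCoords]
    · rw [← h₁, LinearIsometry.inner_map_map, inner_single_one_lastCoords]
  choose f hf using hx
  have hinj := (lastCoordsₗᵢ m).injective
  let φ : E m →ₗᵢ[ℝ] E m :=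
    { toFun := f
      map_add' := fun x y => hinj (by simp [hf])
      map_smul' := fun c x => hinj (by simp [hf])
      norm_map' := fun x => by
        change ‖f x‖ = ‖x‖
        rw [← norm_lastCoords, hf, LinearIsometry.norm_map, norm_lastCoords] }
  obtain ⟨l, hl, -, h⟩ := exists_reflProd_eq (φ.toLinearIsometryEquiv rfl)
  have hl' : ∀ v ∈ l.map (lastCoords m), ‖v‖ = 1 := by simpa [norm_lastCoords] using hl
  -- Reflections in vectors of the last coordinates fix `e₀` and `e₁`, so those that generate the
  -- restriction generate the whole rotation.
  have hrot (y : E (m + 2)) : spinRot g y = reflProd (l.map (lastCoords m)) y := by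
    rw [eq_single_add_single_add_lastCoords y]
    simp only [map_add, map_smul, h₀, h₁, reflProd_map_lastCoords, h]
    rw [reflProd_of_inner_eq_zero, reflProd_of_inner_eq_zero, ← hf]
    · rfl
    · simp only [List.mem_map, forall_exists_index, and_imp, forall_apply_eq_imp_iff₂]
      intro v _
      rw [real_inner_comm, inner_single_one_lastCoords]
    · simp only [List.mem_map, forall_exists_index, and_imp, forall_apply_eq_imp_iff₂]
      intro v _
      rw [real_inner_comm, inner_single_zero_lastCoords]
  obtain ⟨heven, hg | hg⟩ := spin_eq_or_eq_neg_vecProd hl' hrot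
  · rw [List.length_map] at heven
    exact ⟨⟨_, vecProd_mem_spinGroup hl heven⟩, Subtype.ext ((map_vecProd l).trans hg.symm)⟩
  · rw [List.length_map] at heven
    have he : ‖(EuclideanSpace.single (⟨0, hm⟩ : Fin m) 1 : E m)‖ = 1 := by simp
    refine ⟨⟨-vecProd l, ?_⟩, Subtype.ext ?_⟩
    · rw [neg_vecProd_eq he]
      refine vecProd_mem_spinGroup ?_ (by simpa [Nat.even_add_one] using heven)
      simp only [List.mem_cons, forall_eq_or_imp, norm_neg]
      exact ⟨he, he, hl⟩
    · rw [hg, coe_spinIncl, map_neg, map_vecProd]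

end Stabilizer

/-! ### The bundle of Spin(m+2) over the orthonormal 2-frames -/

section Frames

variable {m : ℕ}

@[simp] theorem coe_spinAct (g : Spin m) (x : USphere m) : (spinAct g x : E m) = spinRot g x := rfl

@[simp] theorem coe_basisPt (i : Fin m) : (basisPt i : E m) = EuclideanSpace.single i 1 := rfl

theorem spinAct_mul (g h : Spin m) (x : USphere m) :
    spinAct (g * h) x = spinAct g (spinAct h x) := Subtype.ext (spinRot_mul g h x)

theorem spinAct_one (x : USphere m) : spinAct 1 x = x := Subtype.ext (spinRot_one (x : E m))

theorem spinAct_inv_spinAct (g : Spin m) (x : USphere m) : spinAct g⁻¹ (spinAct g x) = x := by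
  rw [← spinAct_mul, inv_mul_cancel, spinAct_one]

theorem spinAct_spinAct_inv (g : Spin m) (x : USphere m) : spinAct g (spinAct g⁻¹ x) = x := by
  rw [← spinAct_mul, mul_inv_cancel, spinAct_one]

theorem continuous_spinAct : Continuous fun p : Spin m × USphere m => spinAct p.1 p.2 :=
  Continuous.subtype_mk (continuous_spinRot.comp
    (continuous_fst.prodMk (continuous_subtype_val.comp continuous_snd))) _

theorem ContinuousOn.spinAct {X : Type*} [TopologicalSpace X] {f : X → Spin m} {x : X → USphere m}
    {s : Set X} (hf : ContinuousOn f s) (hx : ContinuousOn x s) :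
    ContinuousOn (fun t => spinAct (f t) (x t)) s := by
  have h := hf.prodMk hx
  have h' := continuous_spinAct.comp_continuousOn h
  exact h'

/-- The action of `Spin(m + 2)` on orthonormal `2`-frames. -/
noncomputable def frameAct (g : Spin (m + 2)) (p : TwoFrames m) : TwoFrames m :=
  ⟨(spinAct g p.1.1, spinAct g p.1.2), by
    simpa [(spinRot g).inner_map_map] using p.2⟩

theorem frameAct_frameAct_inv (g : Spin (m + 2)) (p : TwoFrames m) :
    frameAct g (frameAct g⁻¹ p) = p :=
  Subtype.ext (Prod.ext (spinAct_spinAct_inv _ _) (spinAct_spinAct_inv _ _))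

theorem spinFrame_mul (g h : Spin (m + 2)) : spinFrame m (g * h) = frameAct g (spinFrame m h) :=
  Subtype.ext (Prod.ext (spinAct_mul _ _ _) (spinAct_mul _ _ _))

theorem continuous_frameAct_right (g : Spin (m + 2)) :
    Continuous fun p : TwoFrames m => frameAct g p := by
  have h₁ : Continuous fun p : TwoFrames m => (g, p.1.1) := by fun_prop
  have h₂ : Continuous fun p : TwoFrames m => (g, p.1.2) := by fun_prop
  exact ((continuous_spinAct.comp h₁).prodMk (continuous_spinAct.comp h₂)).subtype_mk _

theorem continuous_spinFrame (m : ℕ) : Continuous (spinFrame m) := by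
  have h (x : USphere (m + 2)) : Continuous fun g : Spin (m + 2) => (g, x) := by fun_prop
  exact ((continuous_spinAct.comp (h _)).prodMk (continuous_spinAct.comp (h _))).subtype_mk _

theorem spinFrame_eq_iff (hm : 1 ≤ m) (g h : Spin (m + 2)) :
    spinFrame m g = spinFrame m h ↔ ∃ k : Spin m, spinIncl m k = g⁻¹ * h := by
  constructor
  · intro hgh
    have h₀ : spinAct g (basisPt 0) = spinAct h (basisPt 0) :=
      congrArg (fun p : TwoFrames m => p.1.1) hgh
    have h₁ : spinAct g (basisPt 1) = spinAct h (basisPt 1) :=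
      congrArg (fun p : TwoFrames m => p.1.2) hgh
    refine exists_spinIncl_eq hm ?_ ?_
    · rw [← coe_basisPt, ← coe_spinAct, spinAct_mul, ← h₀, spinAct_inv_spinAct]
    · rw [← coe_basisPt, ← coe_spinAct, spinAct_mul, ← h₁, spinAct_inv_spinAct]
  · rintro ⟨k, hk⟩
    have : h = g * spinIncl m k := by rw [hk, mul_inv_cancel_left]
    rw [this]
    refine Subtype.ext (Prod.ext ?_ ?_)
    · refine Eq.symm ((spinAct_mul _ _ _).trans (congrArg (spinAct g) (Subtype.ext ?_)))
      exact spinRot_spinIncl_single_zero hm k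
    · refine Eq.symm ((spinAct_mul _ _ _).trans (congrArg (spinAct g) (Subtype.ext ?_)))
      exact spinRot_spinIncl_single_one hm k

/-- The unit vector in the direction of `w` (with value `d` if `w = 0`). -/
noncomputable def unitVec (d : USphere m) (w : E m) : USphere m :=
  open Classical in
  if h : w = 0 then d else ⟨‖w‖⁻¹ • w, mem_sphere_zero_iff_norm.2 (norm_smul_inv_norm h)⟩

theorem coe_unitVec (d : USphere m) {w : E m} (h : w ≠ 0) : (unitVec d w : E m) = ‖w‖⁻¹ • w := by
  rw [unitVec, dif_neg h]

theorem vecRefl_unitVec (d : USphere m) {w : E m} (h : w ≠ 0) (x : E m) :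
    vecRefl (unitVec d w : E m) x = vecRefl w x := by
  have hw : ‖w‖ ≠ 0 := norm_ne_zero_iff.2 h
  rw [vecRefl_apply_of_norm_eq_one (norm_eq_of_mem_sphere _), coe_unitVec d h, vecRefl_apply,
    real_inner_smul_left, smul_smul]
  congr 2
  field_simp

theorem continuousAt_unitVec (d : USphere m) {w : E m} (h : w ≠ 0) :
    ContinuousAt (unitVec d) w := by
  rw [IsInducing.subtypeVal.continuousAt_iff]
  have : (fun w : E m => ‖w‖⁻¹ • w) =ᶠ[𝓝 w] Subtype.val ∘ unitVec d := by
    filter_upwards [isOpen_ne.mem_nhds h] with w hw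
    exact (coe_unitVec d hw).symm
  refine ContinuousAt.congr ?_ this
  exact (continuousAt_id.norm.inv₀ (norm_ne_zero_iff.2 h)).smul continuousAt_id

/-- A rotation that moves `x` to `y` and fixes the vectors orthogonal to both (if `y ≠ -x`). -/
noncomputable def spinMove (x y : USphere m) : Spin m := spinPair (unitVec x (x + y : E m)) x

/-- Reflection in `x` sends `x` to `-x`, and reflection in `x + y` sends `-x` to `y`. -/
theorem spinRot_spinMove {x y : USphere m} (h : (x + y : E m) ≠ 0) :
    spinRot (spinMove x y) x = y := by
  have hrefl : vecRefl (x + y : E m) (y : E m) = -x := by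
    rw [add_comm, ← sub_neg_eq_add]
    exact vecRefl_sub (by simp)
  rw [spinMove, spinRot_spinPair, vecRefl_unitVec x h, vecRefl_self, ← hrefl, vecRefl_vecRefl]

theorem spinRot_spinMove_of_inner_eq_zero {x y : USphere m} (h : (x + y : E m) ≠ 0) {z : E m}
    (hx : ⟪(x : E m), z⟫ = 0) (hy : ⟪(y : E m), z⟫ = 0) : spinRot (spinMove x y) z = z := by
  rw [spinMove, spinRot_spinPair, vecRefl_unitVec x h, vecRefl_of_inner_eq_zero hx,
    vecRefl_of_inner_eq_zero (by rw [inner_add_left, hx, hy, add_zero])]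

theorem continuousAt_spinMove {x y : USphere m} (h : (x + y : E m) ≠ 0) :
    ContinuousAt (spinMove x) y := by
  refine (continuous_spinPair.continuousAt.comp (x := y) (f := fun y : USphere m =>
    (unitVec x (x + y : E m), x)) (ContinuousAt.prodMk ?_ continuousAt_const))
  refine (continuousAt_unitVec x h).comp (f := fun y : USphere m => (x + y : E m)) ?_
  exact (continuous_const.add continuous_subtype_val).continuousAt

/-- For a frame `(u, v)`, the image of `v` under the standard rotation from `u` to `e₀`. -/
noncomputable def moveBack (p : TwoFrames m) : USphere (m + 2) :=
  spinAct (spinMove (basisPt 0) p.1.1)⁻¹ p.1.2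

/-- The frames over which `frameLift` is a section of `spinFrame`. -/
def frameDomain (m : ℕ) : Set (TwoFrames m) :=
  {p | ((basisPt 0 : USphere (m + 2)) + p.1.1 : E (m + 2)) ≠ 0 ∧
    ((basisPt 1 : USphere (m + 2)) + moveBack p : E (m + 2)) ≠ 0}

/-- A section of `spinFrame` over `frameDomain`. -/
noncomputable def frameLift (p : TwoFrames m) : Spin (m + 2) :=
  spinMove (basisPt 0) p.1.1 * spinMove (basisPt 1) (moveBack p)

theorem inner_basisPt_zero_basisPt_one :
    ⟪((basisPt 0 : USphere (m + 2)) : E (m + 2)), (basisPt 1 : USphere (m + 2))⟫ = 0 := by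
  simp [EuclideanSpace.inner_single_left]

theorem inner_basisPt_zero_moveBack {p : TwoFrames m}
    (h : ((basisPt 0 : USphere (m + 2)) + p.1.1 : E (m + 2)) ≠ 0) :
    ⟪((basisPt 0 : USphere (m + 2)) : E (m + 2)), moveBack p⟫ = 0 := by
  rw [moveBack, coe_spinAct, ← (spinRot (spinMove (basisPt 0) p.1.1)).inner_map_map,
    spinRot_spinRot_inv, spinRot_spinMove h, p.2]

theorem spinFrame_frameLift {p : TwoFrames m} (hp : p ∈ frameDomain m) :
    spinFrame m (frameLift p) = p := by
  have h₀ := inner_basisPt_zero_moveBack hp.1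
  have h₁ := inner_basisPt_zero_basisPt_one (m := m)
  refine Subtype.ext (Prod.ext (Subtype.ext ?_) (Subtype.ext ?_))
  · change spinRot (frameLift p) (basisPt 0 : USphere (m + 2)) = p.1.1
    -- The right-hand factor moves within the complement of `e₀`, so it leaves `e₀` to the left-hand
    -- one.
    rw [frameLift, spinRot_mul, spinRot_spinMove_of_inner_eq_zero hp.2, spinRot_spinMove hp.1]
    · rw [real_inner_comm, h₁]
    · rw [real_inner_comm, h₀]
  · change spinRot (frameLift p) (basisPt 1 : USphere (m + 2)) = p.1.2
    rw [frameLift, spinRot_mul, spinRot_spinMove hp.2, moveBack, coe_spinAct, spinRot_spinRot_inv]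

theorem isOpen_frameDomain_and_continuousOn_frameLift (m : ℕ) :
    IsOpen (frameDomain m) ∧ ContinuousOn (frameLift (m := m)) (frameDomain m) := by
  let U : Set (TwoFrames m) := {p | ((basisPt 0 : USphere (m + 2)) + p.1.1 : E (m + 2)) ≠ 0}
  have hU : IsOpen U := isOpen_ne_fun (by fun_prop) continuous_const
  have hmove : ContinuousOn (fun p : TwoFrames m => spinMove (basisPt 0) p.1.1) U := by
    intro p hp
    refine ContinuousAt.continuousWithinAt ?_
    refine (continuousAt_spinMove hp).comp (f := fun p : TwoFrames m => p.1.1) ?_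
    fun_prop
  have hback : ContinuousOn (moveBack (m := m)) U := by
    have h₁ : ContinuousOn (fun p : TwoFrames m => p.1.2) U := by fun_prop
    exact hmove.inv.spinAct h₁
  constructor
  · have hc : ContinuousOn (fun p : TwoFrames m =>
        ((basisPt 1 : USphere (m + 2)) + moveBack p : E (m + 2))) U :=
      continuousOn_const.add (continuous_subtype_val.comp_continuousOn hback)
    exact hc.isOpen_inter_preimage hU isOpen_ne
  · intro p hp
    have h₂ : ContinuousWithinAt (fun p : TwoFrames m => spinMove (basisPt 1) (moveBack p)) U p :=
      (continuousAt_spinMove hp.2).comp_continuousWithinAt (hback p hp.1)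
    exact ((hmove p hp.1).mul h₂).mono fun q hq => hq.1

theorem spinFrame_one_mem_frameDomain (m : ℕ) : spinFrame m 1 ∈ frameDomain m := by
  have hne {k : ℕ} (x : USphere k) : (x + x : E k) ≠ 0 := by
    rw [← two_smul ℝ, smul_ne_zero_iff_right two_ne_zero]
    exact ne_zero_of_mem_unit_sphere x
  have h0 : (spinFrame m 1).1.1 = basisPt 0 := spinAct_one _
  have h1 : (spinFrame m 1).1.2 = basisPt 1 := spinAct_one _
  have hb : moveBack (spinFrame m 1) = basisPt 1 := by
    apply Subtype.ext
    rw [moveBack, h0, h1, coe_spinAct]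
    have := spinRot_spinMove_of_inner_eq_zero (hne (basisPt 0 : USphere (m + 2)))
      inner_basisPt_zero_basisPt_one inner_basisPt_zero_basisPt_one
    conv_lhs => rw [← this]
    exact spinRot_inv_spinRot _ _
  refine ⟨?_, ?_⟩
  · rw [h0]; exact hne _
  · rw [hb]; exact hne _

/-- `Spin(m + 2)` acts transitively on orthonormal `2`-frames. -/
theorem spinFrame_surjective (hm : 1 ≤ m) : Function.Surjective (spinFrame m) := by
  -- A spare direction for the antipodal cases, where `spinMove` is undefined in effect: the half
  -- turn in the plane of `eᵢ` and `e₂` sends `eᵢ` to `-eᵢ`.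
  let e₂ : USphere (m + 2) := basisPt ⟨2, by omega⟩
  have h₀₂ : ⟪(e₂ : E (m + 2)), (basisPt 0 : USphere (m + 2))⟫ = 0 := by
    simp [e₂, EuclideanSpace.inner_single_left, Fin.ext_iff]
  have h₁₂ : ⟪(e₂ : E (m + 2)), (basisPt 1 : USphere (m + 2))⟫ = 0 := by
    simp [e₂, EuclideanSpace.inner_single_left, Fin.ext_iff]
  intro p
  obtain ⟨g, hg⟩ : ∃ g : Spin (m + 2), spinRot g (basisPt 0 : USphere (m + 2)) = p.1.1 := by
    by_cases h : ((basisPt 0 : USphere (m + 2)) + p.1.1 : E (m + 2)) = 0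
    · refine ⟨spinPair (basisPt 0) e₂, ?_⟩
      rw [spinRot_spinPair, vecRefl_of_inner_eq_zero h₀₂, vecRefl_self, neg_eq_of_add_eq_zero_right h]
    · exact ⟨_, spinRot_spinMove h⟩
  let v := spinAct g⁻¹ p.1.2
  have hv : ⟪((basisPt 0 : USphere (m + 2)) : E (m + 2)), v⟫ = 0 := by
    rw [coe_spinAct, ← (spinRot g).inner_map_map, spinRot_spinRot_inv, hg, p.2]
  obtain ⟨h, h₀, h₁⟩ : ∃ h : Spin (m + 2),
      spinRot h (basisPt 0 : USphere (m + 2)) = (basisPt 0 : USphere (m + 2)) ∧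
      spinRot h (basisPt 1 : USphere (m + 2)) = v := by
    by_cases h : ((basisPt 1 : USphere (m + 2)) + v : E (m + 2)) = 0
    · refine ⟨spinPair (basisPt 1) e₂, ?_, ?_⟩
      · rw [spinRot_spinPair, vecRefl_of_inner_eq_zero h₀₂, vecRefl_of_inner_eq_zero]
        rw [real_inner_comm, inner_basisPt_zero_basisPt_one]
      · rw [spinRot_spinPair, vecRefl_of_inner_eq_zero h₁₂, vecRefl_self,
          neg_eq_of_add_eq_zero_right h]
    · refine ⟨_, spinRot_spinMove_of_inner_eq_zero h ?_ ?_, spinRot_spinMove h⟩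
      · rw [real_inner_comm, inner_basisPt_zero_basisPt_one]
      · rw [real_inner_comm, hv]
  refine ⟨g * h, Subtype.ext (Prod.ext (Subtype.ext ?_) (Subtype.ext ?_))⟩
  · exact (spinRot_mul _ _ _).trans (by rw [h₀, hg])
  · exact (spinRot_mul _ _ _).trans (by rw [h₁, coe_spinAct, spinRot_spinRot_inv])

/-- `Spin(m + 2) / Spin(m)` is homeomorphic to the space of orthonormal `2`-frames. -/
theorem exists_homeomorph_quotient_twoFrames (hm : 1 ≤ m) :
    ∃ e : (Spin (m + 2) ⧸ (spinIncl m).range) ≃ₜ TwoFrames m,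
      ∀ g : Spin (m + 2), e (QuotientGroup.mk g) = spinFrame m g := by
  have : CompactSpace (Spin (m + 2)) := compactSpace_spin (by omega)
  let f : (Spin (m + 2) ⧸ (spinIncl m).range) → TwoFrames m :=
    Quotient.lift (spinFrame m) fun g h hgh =>
      (spinFrame_eq_iff hm g h).2 (QuotientGroup.leftRel_apply.1 hgh)
  have hf : Continuous f := (continuous_spinFrame m).quotient_lift _
  have hbij : Function.Bijective f := by
    constructor
    · intro x y
      induction x using QuotientGroup.induction_on with | H g
      induction y using QuotientGroup.induction_on with | H h
      intro hgh
      exact QuotientGroup.eq.2 ((spinFrame_eq_iff hm g h).1 hgh)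
    · intro p
      obtain ⟨g, hg⟩ := spinFrame_surjective hm p
      exact ⟨QuotientGroup.mk g, hg⟩
  exact ⟨Continuous.homeoOfEquivCompactToT2 (f := Equiv.ofBijective f hbij) hf, fun g => rfl⟩

/-- A local section of `spinFrame` yields a local trivialization. -/
theorem exists_trivialization_of_section (hm : 1 ≤ m) {U : Set (TwoFrames m)} (hU : IsOpen U)
    {s : TwoFrames m → Spin (m + 2)} (hs : ContinuousOn s U) (h : ∀ p ∈ U, spinFrame m (s p) = p) :
    ∃ τ : Bundle.Trivialization (Spin m) (spinFrame m), τ.baseSet = U := by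
  -- Arbitrary off the range of the inclusion, but applied only to `(s p)⁻¹ * g` with `g` over `p`,
  -- which stabilizes the base frame.
  let ψ : Spin (m + 2) → Spin m := Function.invFun (spinIncl m)
  have hψ (k : Spin m) : ψ (spinIncl m k) = k := Function.leftInverse_invFun (spinIncl_injective m) k
  have hincl (g : Spin (m + 2)) (hg : spinFrame m g ∈ U) :
      spinIncl m (ψ ((s (spinFrame m g))⁻¹ * g)) = (s (spinFrame m g))⁻¹ * g := by
    obtain ⟨k, hk⟩ := (spinFrame_eq_iff hm (s (spinFrame m g)) g).1 (h _ hg)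
    rw [← hk, hψ]
  have hframe (p : TwoFrames m) (hp : p ∈ U) (k : Spin m) :
      spinFrame m (s p * spinIncl m k) = p := by
    rw [← (spinFrame_eq_iff hm (s p) (s p * spinIncl m k)).2 ⟨k, by group⟩, h p hp]
  refine ⟨{
    toFun := fun g => (spinFrame m g, ψ ((s (spinFrame m g))⁻¹ * g))
    invFun := fun q => s q.1 * spinIncl m q.2
    source := spinFrame m ⁻¹' U
    target := U ×ˢ univ
    map_source' := fun g hg => ⟨hg, mem_univ _⟩
    map_target' := ?_
    left_inv' := ?_
    right_inv' := ?_
    open_source := hU.preimage (continuous_spinFrame m)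
    open_target := hU.prod isOpen_univ
    continuousOn_toFun := ?_
    continuousOn_invFun := ?_
    baseSet := U
    open_baseSet := hU
    source_eq := rfl
    target_eq := rfl
    proj_toFun := fun _ _ => rfl }, rfl⟩
  · rintro ⟨p, k⟩ ⟨hp, -⟩
    change spinFrame m (s p * spinIncl m k) ∈ U
    rwa [hframe p hp]
  · intro g hg
    change s (spinFrame m g) * spinIncl m (ψ ((s (spinFrame m g))⁻¹ * g)) = g
    rw [hincl g hg, mul_inv_cancel_left]
  · rintro ⟨p, k⟩ ⟨hp, -⟩
    simp only [hframe p hp, inv_mul_cancel_left, hψ]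
  · refine (continuous_spinFrame m).continuousOn.prodMk ?_
    -- Continuity may be tested after the embedding, where `ψ` disappears.
    rw [(isEmbedding_spinIncl hm).isInducing.continuousOn_iff]
    refine ContinuousOn.congr (f := fun g => (s (spinFrame m g))⁻¹ * g) ?_ fun g hg => hincl g hg
    exact (hs.comp (continuous_spinFrame m).continuousOn fun g hg => hg).inv.mul continuousOn_id
  · refine ContinuousOn.mul ?_ ?_
    · exact hs.comp continuousOn_fst fun q hq => hq.1
    · exact ((continuous_spinIncl m).comp continuous_snd).continuousOn

/-- The section near the base frame is carried to any other frame by left translation. -/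
theorem exists_trivialization_spinFrame (hm : 1 ≤ m) (p : TwoFrames m) :
    ∃ τ : Bundle.Trivialization (Spin m) (spinFrame m), p ∈ τ.baseSet := by
  obtain ⟨g, rfl⟩ := spinFrame_surjective hm p
  obtain ⟨hopen, hcont⟩ := isOpen_frameDomain_and_continuousOn_frameLift m
  have hact := continuous_frameAct_right g⁻¹
  have hlift : ContinuousOn (fun q => frameLift (frameAct g⁻¹ q))
      ((fun q => frameAct g⁻¹ q) ⁻¹' frameDomain m) :=
    hcont.comp hact.continuousOn fun q hq => hq
  have hs : ContinuousOn (fun q => g * frameLift (frameAct g⁻¹ q))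
      ((fun q => frameAct g⁻¹ q) ⁻¹' frameDomain m) := hlift.const_mul g
  obtain ⟨τ, hτ⟩ := exists_trivialization_of_section hm (hopen.preimage hact) hs fun q hq => by
    rw [spinFrame_mul, spinFrame_frameLift hq, frameAct_frameAct_inv]
  refine ⟨τ, ?_⟩
  rw [hτ, mem_preimage, ← spinFrame_mul, inv_mul_cancel]
  exact spinFrame_one_mem_frameDomain m

end Frames

/-! ### An identification of the frames with a product of spheres -/

section Identification

variable {m : ℕ}

/-- With division by zero equal to zero, the formula for the reflection is measurable also where `f`
vanishes; hence the identification is Borel everywhere. -/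
theorem Measurable.vecRefl {X : Type*} [MeasurableSpace X] {f g : X → E m} (hf : Measurable f)
    (hg : Measurable g) : Measurable fun t => vecRefl (f t) (g t) := by
  simp only [vecRefl_apply]
  fun_prop

theorem ContinuousOn.vecRefl {X : Type*} [TopologicalSpace X] {f g : X → E m} {s : Set X}
    (hf : ContinuousOn f s) (hg : ContinuousOn g s) (h : ∀ t ∈ s, f t ≠ 0) :
    ContinuousOn (fun t => vecRefl (f t) (g t)) s := by
  simp only [vecRefl_apply]
  have : ∀ t ∈ s, ‖f t‖ ^ 2 ≠ 0 := fun t ht => pow_ne_zero _ (norm_ne_zero_iff.2 (h t ht))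
  fun_prop (disch := assumption)

/-- The inclusion `ℝ^m → ℝ^(m+1)` as the last `m` coordinates. -/
noncomputable def consZero (m : ℕ) : E m →ₗᵢ[ℝ] E (m + 1) where
  toFun x := WithLp.toLp 2 (Fin.cons 0 x)
  map_add' x y := by
    ext i
    refine Fin.cases ?_ (fun i => ?_) i <;> simp
  map_smul' c x := by
    ext i
    refine Fin.cases ?_ (fun i => ?_) i <;> simp
  norm_map' x := by
    simp [EuclideanSpace.norm_eq, Fin.sum_univ_succ]

/-- The projection `ℝ^(m+1) → ℝ^m` on the last `m` coordinates. -/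
noncomputable def dropZero (y : E (m + 1)) : E m := WithLp.toLp 2 fun i => y i.succ

theorem dropZero_consZero (x : E m) : dropZero (consZero m x) = x := rfl

theorem consZero_apply_zero (x : E m) : consZero m x 0 = 0 := rfl

theorem consZero_dropZero {y : E (m + 1)} (h : ⟪EuclideanSpace.single 0 1, y⟫ = 0) :
    consZero m (dropZero y) = y := by
  have h' : y 0 = 0 := by simpa [EuclideanSpace.inner_single_left] using h
  ext i
  refine Fin.cases ?_ (fun i => rfl) i
  rw [h', consZero_apply_zero]

theorem continuous_dropZero : Continuous (dropZero : E (m + 1) → E m) := by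
  unfold dropZero
  fun_prop

theorem vecRefl_add_left (u v : USphere m) : vecRefl (u + v : E m) (u : E m) = -(v : E m) := by
  rw [← sub_neg_eq_add]
  exact vecRefl_sub (by simp)

theorem vecRefl_add_right (u v : USphere m) : vecRefl (u + v : E m) (v : E m) = -(u : E m) := by
  rw [add_comm, vecRefl_add_left]

/-- The reflection sends `u` to `-e₀`, hence the complement of `u` to that of `e₀`. At `u = -e₀` it
is the identity and this remains true. -/
theorem inner_single_zero_vecRefl {u : USphere (m + 1)} {v : E (m + 1)} (h : ⟪(u : E (m + 1)), v⟫ = 0) :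
    ⟪EuclideanSpace.single 0 1, vecRefl ((basisPt 0 : USphere (m + 1)) + u : E (m + 1)) v⟫ = 0 := by
  rw [← (vecRefl ((basisPt 0 : USphere (m + 1)) + u : E (m + 1))).inner_map_map, vecRefl_vecRefl,
    ← coe_basisPt, vecRefl_add_left, inner_neg_left, h, neg_zero]

/-- The identification of `TwoFrames m` with the product of spheres by which the fibre over `u`
is reflected in the hyperplane orthogonal to `e₀ + u`. -/
noncomputable def reflIdentification (m : ℕ) : ProductIdentification m where
  toMeasurableEquiv :=
    { toFun := fun p => (p.1.1,
        ⟨dropZero (vecRefl ((basisPt 0 : USphere (m + 2)) + p.1.1 : E (m + 2)) p.1.2), by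
          rw [mem_sphere_zero_iff_norm, ← (consZero (m + 1)).norm_map, consZero_dropZero
            (inner_single_zero_vecRefl p.2), LinearIsometryEquiv.norm_map, norm_eq_of_mem_sphere]⟩)
      invFun := fun q => ⟨(q.1,
        ⟨vecRefl ((basisPt 0 : USphere (m + 2)) + q.1 : E (m + 2)) (consZero (m + 1) q.2), by
          rw [mem_sphere_zero_iff_norm, LinearIsometryEquiv.norm_map, LinearIsometry.norm_map,
            norm_eq_of_mem_sphere]⟩), by
        change ⟪(q.1 : E (m + 2)),
          vecRefl ((basisPt 0 : USphere (m + 2)) + q.1 : E (m + 2)) (consZero (m + 1) q.2)⟫ = 0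
        rw [← (vecRefl ((basisPt 0 : USphere (m + 2)) + q.1 : E (m + 2))).inner_map_map,
          vecRefl_vecRefl, vecRefl_add_right, inner_neg_left, coe_basisPt,
          EuclideanSpace.inner_single_left, consZero_apply_zero, mul_zero, neg_zero]⟩
      left_inv := fun p => by
        refine Subtype.ext (Prod.ext rfl (Subtype.ext ?_))
        simp only [consZero_dropZero (inner_single_zero_vecRefl p.2), vecRefl_vecRefl]
      right_inv := fun q => by
        refine Prod.ext rfl (Subtype.ext ?_)
        simp only [vecRefl_vecRefl, dropZero_consZero]
      measurable_toFun := by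
        refine Measurable.prodMk (by fun_prop) (Measurable.subtype_mk ?_)
        refine continuous_dropZero.measurable.comp (Measurable.vecRefl ?_ ?_) <;> fun_prop
      measurable_invFun := by
        refine Measurable.subtype_mk (Measurable.prodMk (by fun_prop) (Measurable.subtype_mk ?_))
        refine Measurable.vecRefl (by fun_prop) ?_
        exact (consZero (m + 1)).continuous.measurable.comp (by fun_prop) }
  fst_eq _ := rfl
  isometry_fibre p q h := by
    change dist (dropZero (vecRefl ((basisPt 0 : USphere (m + 2)) + p.1.1 : E (m + 2)) p.1.2))
      (dropZero (vecRefl ((basisPt 0 : USphere (m + 2)) + q.1.1 : E (m + 2)) q.1.2)) = _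
    rw [← (consZero (m + 1)).dist_map, consZero_dropZero (inner_single_zero_vecRefl p.2),
      consZero_dropZero (inner_single_zero_vecRefl q.2), h, LinearIsometryEquiv.dist_map]
    rfl

/-- The reflecting vector `e₀ + u` vanishes only at `u = -e₀`, which is the exceptional point `c`.
-/
theorem exists_identification_continuousOn (m : ℕ) :
    ∃ (Φ : ProductIdentification m) (c : USphere (m + 2)),
      ContinuousOn Φ.toMeasurableEquiv {p | p.1.1 ≠ c} ∧
      ContinuousOn Φ.toMeasurableEquiv.symm {q | q.1 ≠ c} := by
  have hne {u : USphere (m + 2)} (h : u ≠ -basisPt 0) :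
      ((basisPt 0 : USphere (m + 2)) + u : E (m + 2)) ≠ 0 := fun h' =>
    h (Subtype.ext (neg_eq_of_add_eq_zero_right h').symm)
  refine ⟨reflIdentification m, -basisPt 0, ?_, ?_⟩
  · have h : ContinuousOn (fun p : TwoFrames m =>
        vecRefl ((basisPt 0 : USphere (m + 2)) + p.1.1 : E (m + 2)) p.1.2)
        {p | p.1.1 ≠ -basisPt 0} :=
      ContinuousOn.vecRefl (by fun_prop) (by fun_prop) fun p hp => hne hp
    refine ContinuousOn.prodMk (by fun_prop) ?_
    rw [IsInducing.subtypeVal.continuousOn_iff]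
    exact continuous_dropZero.comp_continuousOn h
  · have h : ContinuousOn (fun q : USphere (m + 2) × USphere (m + 1) =>
        vecRefl ((basisPt 0 : USphere (m + 2)) + q.1 : E (m + 2)) (consZero (m + 1) q.2))
        {q | q.1 ≠ -basisPt 0} := by
      refine ContinuousOn.vecRefl (by fun_prop) ?_ fun q hq => hne hq
      exact ((consZero (m + 1)).continuous.comp (by fun_prop)).continuousOn
    refine (IsInducing.subtypeVal (t := {p : USphere (m + 2) × USphere (m + 2) |
      ⟪(p.1 : E (m + 2)), (p.2 : E (m + 2))⟫ = 0})).continuousOn_iff.2 ?_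
    refine ContinuousOn.prodMk (by fun_prop) ?_
    rw [IsInducing.subtypeVal.continuousOn_iff]
    exact h

end Identification

/-! ### Equators as spheres of one dimension less -/

section Equator

theorem nonempty_equator_homeomorph {m : ℕ} (a : USphere (m + 1)) :
    Nonempty (equator a ≃ₜ USphere m) := by
  have : Fact (Module.finrank ℝ (E (m + 1)) = m + 1) := ⟨finrank_euclideanSpace_fin⟩
  let φ : (ℝ ∙ (a : E (m + 1)))ᗮ ≃ₗᵢ[ℝ] E m := (OrthonormalBasis.fromOrthogonalSpanSingleton m
    (ne_zero_of_mem_unit_sphere a)).repr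
  exact ⟨{
    toFun := fun x => ⟨φ ⟨x.1, Submodule.mem_orthogonal_singleton_iff_inner_right.2 x.2⟩, by
      rw [mem_sphere_zero_iff_norm, LinearIsometryEquiv.norm_map]
      exact norm_eq_of_mem_sphere x.1⟩
    invFun := fun y => ⟨⟨φ.symm y, by
      rw [mem_sphere_zero_iff_norm]
      exact (φ.symm.norm_map y).trans (norm_eq_of_mem_sphere y)⟩,
      Submodule.mem_orthogonal_singleton_iff_inner_right.1 (φ.symm y).2⟩
    left_inv := fun x => Subtype.ext (Subtype.ext (by simp))
    right_inv := fun y => Subtype.ext (by simp)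
    continuous_toFun := by
      refine Continuous.subtype_mk (φ.continuous.comp (Continuous.subtype_mk ?_ _)) _
      fun_prop
    continuous_invFun := by
      refine Continuous.subtype_mk (Continuous.subtype_mk ?_ _) _
      exact continuous_subtype_val.comp (φ.symm.continuous.comp continuous_subtype_val) }⟩

theorem nonempty_biEquator_homeomorph {m : ℕ} (a : USphere (m + 2)) (b : USphere (m + 1)) :
    Nonempty (biEquator a b ≃ₜ USphere (m + 1) × USphere m) := by
  obtain ⟨e⟩ := nonempty_equator_homeomorph a
  obtain ⟨f⟩ := nonempty_equator_homeomorph b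
  exact ⟨(Homeomorph.Set.prod _ _).trans (e.prodCongr f)⟩

end Equator

/-! ### The invariant probability measure -/

section Haar

variable {m : ℕ}

theorem isHaarMeasure_spin (hm : 1 ≤ m) (μ : Measure (Spin m)) [IsProbabilityMeasure μ]
    [μ.IsMulLeftInvariant] : μ.IsHaarMeasure := by
  have := compactSpace_spin hm
  exact Measure.isHaarMeasure_of_isCompact_nonempty_interior μ univ isCompact_univ (by simp)
    (by simp) (by simp)

theorem eq_of_isMulLeftInvariant_spin (hm : 1 ≤ m) (μ ν : Measure (Spin m))
    [IsProbabilityMeasure μ] [μ.IsMulLeftInvariant] [IsProbabilityMeasure ν]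
    [ν.IsMulLeftInvariant] : μ = ν := by
  have := compactSpace_spin hm
  have := isHaarMeasure_spin hm μ
  have := isHaarMeasure_spin hm ν
  exact Measure.isHaarMeasure_eq_of_isProbabilityMeasure μ ν

theorem existsUnique_haar_spin (hm : 1 ≤ m) :
    ∃! μ : Measure (Spin m), IsProbabilityMeasure μ ∧ μ.IsMulLeftInvariant := by
  have := compactSpace_spin hm
  refine ⟨Measure.haarMeasure ⊤, ⟨⟨?_⟩, inferInstance⟩, ?_⟩
  · simpa using Measure.haarMeasure_self (K₀ := (⊤ : TopologicalSpace.PositiveCompacts (Spin m)))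
  · rintro ν ⟨h₁, h₂⟩
    have : IsProbabilityMeasure
        (Measure.haarMeasure (⊤ : TopologicalSpace.PositiveCompacts (Spin m))) :=
      ⟨by simpa using
        Measure.haarMeasure_self (K₀ := (⊤ : TopologicalSpace.PositiveCompacts (Spin m)))⟩
    exact eq_of_isMulLeftInvariant_spin hm _ _

/-- A right translate of `μ` is again a left-invariant probability measure, so uniqueness applies.
-/
theorem isMulRightInvariant_spin (hm : 1 ≤ m) (μ : Measure (Spin m)) [IsProbabilityMeasure μ]
    [μ.IsMulLeftInvariant] : μ.IsMulRightInvariant := by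
  refine ⟨fun g => ?_⟩
  have hmeas : Measurable fun x : Spin m => x * g := (continuous_mul_const g).measurable
  have : IsProbabilityMeasure (μ.map (· * g)) :=
    Measure.isProbabilityMeasure_map hmeas.aemeasurable
  have : (μ.map (· * g)).IsMulLeftInvariant := by
    refine ⟨fun h => ?_⟩
    have hmeas' : Measurable fun x : Spin m => h * x := (continuous_const_mul h).measurable
    rw [Measure.map_map hmeas' hmeas]
    conv_rhs => rw [← map_mul_left_eq_self μ h]
    rw [Measure.map_map hmeas hmeas']
    congr 1
    ext x : 1
    exact (mul_assoc _ _ _).symm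
  exact eq_of_isMulLeftInvariant_spin hm _ _

end Haar

/-! ### Second moments and Chebyshev's inequality -/

section Chebyshev

variable {m : ℕ}

theorem sum_inner_spinRot_sq (g : Spin m) (x : E m) :
    ∑ i, ⟪x, spinRot g (EuclideanSpace.single i 1)⟫ ^ 2 = ‖x‖ ^ 2 := by
  have h := ((EuclideanSpace.basisFun (Fin m) ℝ).map (spinRotEquiv g)).sum_sq_norm_inner_left x
  simpa using h

theorem continuous_spinAct_left (x : USphere m) : Continuous fun g : Spin m => spinAct g x := by
  have h : Continuous fun g : Spin m => (g, x) := by fun_prop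
  have h' := continuous_spinAct.comp h
  exact h'

theorem continuous_spinRot_left (x : E m) : Continuous fun g : Spin m => spinRot g x := by
  have h : Continuous fun g : Spin m => (g, x) := by fun_prop
  have h' := continuous_spinRot.comp h
  exact h'

theorem measurable_inner_spinRot {F : USphere m → E m} (hF : Measurable F) (x : USphere m) (y : E m) :
    Measurable fun g : Spin m => ⟪F (spinAct g x), spinRot g y⟫ := by
  have h₁ := hF.comp (continuous_spinAct_left x).measurable
  have h₂ := (continuous_spinRot_left y).measurable
  exact h₁.inner h₂

/-- Given `g e₀`, the vectors `g eᵢ` with `i ≥ 1` are exchangeable, and Parseval bounds the sum of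
the squares by `‖F‖ ^ 2`. Requiring only `‖F‖ ≤ 1` lets a field be set to 0 where it has no natural
value. -/
theorem lintegral_inner_spinRot_sq_le (hm : 1 ≤ m) (μ : Measure (Spin (m + 2)))
    [IsProbabilityMeasure μ] [μ.IsMulLeftInvariant] {F : USphere (m + 2) → E (m + 2)}
    (hF : Measurable F) (hF1 : ∀ u, ‖F u‖ ≤ 1) :
    (m + 1 : ℝ≥0∞) * ∫⁻ g, ENNReal.ofReal (⟪F (spinAct g (basisPt 0)),
      spinRot g (EuclideanSpace.single 1 1)⟫ ^ 2) ∂μ ≤ 1 := by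
  have := isMulRightInvariant_spin (by omega) μ
  let f : Fin (m + 2) → Spin (m + 2) → ℝ≥0∞ := fun i g =>
    ENNReal.ofReal (⟪F (spinAct g (basisPt 0)), spinRot g (EuclideanSpace.single i 1)⟫ ^ 2)
  have hf (i : Fin (m + 2)) : Measurable (f i) :=
    ((measurable_inner_spinRot hF _ _).pow_const 2).ennreal_ofReal
  have heq (i : Fin (m + 1)) : ∫⁻ g, f i.succ g ∂μ = ∫⁻ g, f 1 g ∂μ := by
    have horth : ⟪((basisPt 0 : USphere (m + 2)) : E (m + 2)),
        ((basisPt i.succ : USphere (m + 2)) : E (m + 2))⟫ = 0 := by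
      simp [EuclideanSpace.inner_single_left]
    -- Right translation by `h` keeps `g e₀`, and so the value of `F`, while it replaces `g e₁` by
    -- `g eᵢ₊₁`.
    obtain ⟨h, hh⟩ := spinFrame_surjective hm ⟨(basisPt 0, basisPt i.succ), horth⟩
    have h₀ : spinAct h (basisPt 0) = basisPt 0 := congrArg (fun p : TwoFrames m => p.1.1) hh
    have h₁ : spinAct h (basisPt 1) = basisPt i.succ := congrArg (fun p : TwoFrames m => p.1.2) hh
    rw [← lintegral_mul_right_eq_self (f 1) h]
    refine lintegral_congr fun g => ?_
    simp only [f]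
    rw [spinAct_mul, h₀, spinRot_mul, ← coe_basisPt 1, ← coe_spinAct h, h₁, coe_basisPt]
  calc (m + 1 : ℝ≥0∞) * ∫⁻ g, f 1 g ∂μ = ∑ i : Fin (m + 1), ∫⁻ g, f i.succ g ∂μ := by
        simp [heq]
    _ = ∫⁻ g, ∑ i : Fin (m + 1), f i.succ g ∂μ :=
        (lintegral_finsetSum _ fun i _ => hf _).symm
    _ ≤ ∫⁻ _, 1 ∂μ := by
        refine lintegral_mono fun g => ?_
        calc ∑ i : Fin (m + 1), f i.succ g ≤ ∑ i, f i g := by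
              rw [Fin.sum_univ_succ (n := m + 1)]
              exact le_add_self
          _ = ENNReal.ofReal (‖F (spinAct g (basisPt 0))‖ ^ 2) := by
              rw [← sum_inner_spinRot_sq g, ENNReal.ofReal_sum_of_nonneg fun i _ => sq_nonneg _]
          _ ≤ 1 := by
              rw [ENNReal.ofReal_le_one]
              exact pow_le_one₀ (norm_nonneg _) (hF1 _)
    _ = 1 := by simp

theorem measure_le_abs_inner_one_le (hm : 1 ≤ m) (μ : Measure (Spin (m + 2)))
    [IsProbabilityMeasure μ] [μ.IsMulLeftInvariant] {F : USphere (m + 2) → E (m + 2)}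
    (hF : Measurable F) (hF1 : ∀ u, ‖F u‖ ≤ 1) {δ : ℝ} (hδ : 0 < δ) :
    μ {g | δ ≤ |⟪F (spinAct g (basisPt 0)), spinRot g (EuclideanSpace.single 1 1)⟫|} ≤
      (ENNReal.ofReal ((m + 1) * δ ^ 2))⁻¹ := by
  rw [ENNReal.le_inv_iff_mul_le]
  have hsub : {g : Spin (m + 2) |
      δ ≤ |⟪F (spinAct g (basisPt 0)), spinRot g (EuclideanSpace.single 1 1)⟫|} ⊆
      {g | ENNReal.ofReal (δ ^ 2) ≤ ENNReal.ofReal (⟪F (spinAct g (basisPt 0)),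
        spinRot g (EuclideanSpace.single 1 1)⟫ ^ 2)} := fun g hg => by
    refine ENNReal.ofReal_le_ofReal ?_
    rw [← sq_abs ⟪_, _⟫]
    exact pow_le_pow_left₀ hδ.le hg 2
  have hmeas := ((measurable_inner_spinRot hF (basisPt 0)
    (EuclideanSpace.single 1 1)).pow_const 2).ennreal_ofReal
  have hm' : ENNReal.ofReal (m + 1 : ℝ) = (m + 1 : ℝ≥0∞) := by
    rw [ENNReal.ofReal_add (by positivity) zero_le_one]
    simp
  calc _ ≤ μ {g | ENNReal.ofReal (δ ^ 2) ≤ ENNReal.ofReal (⟪F (spinAct g (basisPt 0)),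
        spinRot g (EuclideanSpace.single 1 1)⟫ ^ 2)} * ENNReal.ofReal ((m + 1) * δ ^ 2) := by
        gcongr
    _ = (m + 1 : ℝ≥0∞) * (ENNReal.ofReal (δ ^ 2) *
        μ {g | ENNReal.ofReal (δ ^ 2) ≤ ENNReal.ofReal (⟪F (spinAct g (basisPt 0)),
        spinRot g (EuclideanSpace.single 1 1)⟫ ^ 2)}) := by
        rw [ENNReal.ofReal_mul (by positivity), hm']
        ring
    _ ≤ _ := mul_le_mul_right (mul_meas_ge_le_lintegral hmeas _) _
    _ ≤ 1 := lintegral_inner_spinRot_sq_le hm μ hF hF1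

/-- Right translation by an element that carries `e₀` to `e₁` reduces this to the constant field
`a`. -/
theorem measure_le_abs_inner_zero_le (hm : 1 ≤ m) (μ : Measure (Spin (m + 2)))
    [IsProbabilityMeasure μ] [μ.IsMulLeftInvariant] (a : USphere (m + 2)) {δ : ℝ} (hδ : 0 < δ) :
    μ {g | δ ≤ |⟪(a : E (m + 2)), spinAct g (basisPt 0)⟫|} ≤
      (ENNReal.ofReal ((m + 1) * δ ^ 2))⁻¹ := by
  have := isMulRightInvariant_spin (by omega) μ
  have horth : ⟪((basisPt 1 : USphere (m + 2)) : E (m + 2)),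
      ((basisPt 0 : USphere (m + 2)) : E (m + 2))⟫ = 0 := by
    simp [EuclideanSpace.inner_single_left]
  obtain ⟨h, hh⟩ := spinFrame_surjective hm ⟨(basisPt 1, basisPt 0), horth⟩
  have h₀ : spinAct h (basisPt 0) = basisPt 1 := congrArg (fun p : TwoFrames m => p.1.1) hh
  rw [← measure_preimage_mul_right μ h]
  refine le_trans (measure_mono fun g hg => ?_) (measure_le_abs_inner_one_le hm μ
    (F := fun _ => (a : E (m + 2))) measurable_const (fun _ => (norm_eq_of_mem_sphere a).le) hδ)
  have h' : δ ≤ |⟪(a : E (m + 2)), spinAct (g * h) (basisPt 0)⟫| := hg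
  rw [spinAct_mul, h₀] at h'
  exact h'

end Chebyshev

/-! ### Heights in the fibres of an identification -/

section Fibre

variable {m : ℕ}

/-- The vector of the fibre over `u` that an identification sends to `b`. -/
noncomputable def fibrePole (Φ : ProductIdentification m) (b : USphere (m + 1))
    (u : USphere (m + 2)) : USphere (m + 2) :=
  (Φ.toMeasurableEquiv.symm (u, b)).1.2

theorem measurable_fibrePole (Φ : ProductIdentification m) (b : USphere (m + 1)) :
    Measurable (fibrePole Φ b) := by
  have h : Measurable fun u : USphere (m + 2) => Φ.toMeasurableEquiv.symm (u, b) :=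
    Φ.toMeasurableEquiv.symm.measurable.comp (by fun_prop)
  exact measurable_snd.comp (measurable_subtype_coe.comp h)

theorem fst_symm_eq (Φ : ProductIdentification m) (u : USphere (m + 2)) (b : USphere (m + 1)) :
    (Φ.toMeasurableEquiv.symm (u, b)).1.1 = u := by
  rw [← Φ.fst_eq, MeasurableEquiv.apply_symm_apply]

theorem inner_fibrePole (Φ : ProductIdentification m) (u : USphere (m + 2)) (b : USphere (m + 1)) :
    ⟪(u : E (m + 2)), fibrePole Φ b u⟫ = 0 := by
  have := (Φ.toMeasurableEquiv.symm (u, b)).2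
  rwa [fst_symm_eq] at this

theorem inner_eq_of_dist_eq {k l : ℕ} {x y : USphere k} {z w : USphere l}
    (h : dist x y = dist z w) : ⟪(x : E k), (y : E k)⟫ = ⟪(z : E l), (w : E l)⟫ := by
  rw [Subtype.dist_eq, Subtype.dist_eq, dist_eq_norm, dist_eq_norm] at h
  have h₁ := norm_sub_sq_real (x : E k) y
  have h₂ := norm_sub_sq_real (z : E l) w
  simp only [norm_eq_of_mem_sphere, h] at h₁ h₂
  linarith

/-- A fibrewise isometry preserves the distance to the point over `b`, hence the inner product; the
second height thus becomes a quantity of the form covered by the moment bound. -/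
theorem inner_spinProj_snd (Φ : ProductIdentification m) (b : USphere (m + 1))
    (g : Spin (m + 2)) :
    ⟪(b : E (m + 1)), (spinProj Φ g).2⟫ =
      ⟪(fibrePole Φ b (spinAct g (basisPt 0)) : E (m + 2)),
        spinRot g (EuclideanSpace.single 1 1)⟫ := by
  have h := Φ.isometry_fibre (Φ.toMeasurableEquiv.symm (spinAct g (basisPt 0), b)) (spinFrame m g)
    (fst_symm_eq _ _ _)
  rw [MeasurableEquiv.apply_symm_apply] at h
  exact inner_eq_of_dist_eq h

theorem spinProj_fst (Φ : ProductIdentification m) (g : Spin (m + 2)) :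
    (spinProj Φ g).1 = spinAct g (basisPt 0) := Φ.fst_eq _

end Fibre

/-! ### Projection to an equator, in terms of the latitude `arcsin ⟪p, x⟫` -/

section EquatorProjection

variable {m : ℕ}

/-- The point of the equator of `p` that is nearest to `x`. -/
noncomputable def equatorProj (p x : USphere m) : USphere m :=
  unitVec p (x - ⟪(p : E m), x⟫ • (p : E m))

theorem measurable_unitVec (d : USphere m) : Measurable (unitVec d) := by
  classical
  refine measurable_comap_iff.2 ?_
  have h : Subtype.val ∘ unitVec d = fun w : E m => if w = 0 then (d : E m) else ‖w‖⁻¹ • w := by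
    ext1 w
    by_cases hw : w = 0
    · simp [unitVec, hw]
    · rw [Function.comp_apply, coe_unitVec d hw, if_neg hw]
  rw [h]
  exact Measurable.ite (measurableSet_eq) measurable_const (by fun_prop)

theorem measurable_equatorProj (p : USphere m) : Measurable (equatorProj p) := by
  have h : Measurable fun x : USphere m => (x - ⟪(p : E m), x⟫ • (p : E m) : E m) := by fun_prop
  exact (measurable_unitVec p).comp h

theorem norm_sub_inner_smul (p x : USphere m) :
    ‖(x - ⟪(p : E m), x⟫ • (p : E m) : E m)‖ = Real.cos (Real.arcsin ⟪(p : E m), x⟫) := by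
  rw [Real.cos_arcsin, ← Real.sqrt_sq (norm_nonneg (x - ⟪(p : E m), x⟫ • (p : E m) : E m)),
    norm_sub_sq_real, norm_smul, inner_smul_right, norm_eq_of_mem_sphere, norm_eq_of_mem_sphere,
    real_inner_comm, mul_one, Real.norm_eq_abs, sq_abs]
  congr 1
  ring

theorem cos_arcsin_pos {s : ℝ} (hs : |s| < 1) : 0 < Real.cos (Real.arcsin s) := by
  rw [Real.cos_arcsin, Real.sqrt_pos, sub_pos, sq_lt_one_iff_abs_lt_one]
  exact hs

/-- Away from the two poles the component of `x` orthogonal to `p` is nonzero, so the default value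
in `unitVec` plays no role. -/
theorem cos_smul_equatorProj {p x : USphere m} (h : |⟪(p : E m), x⟫| < 1) :
    Real.cos (Real.arcsin ⟪(p : E m), x⟫) • (equatorProj p x : E m) =
      x - ⟪(p : E m), x⟫ • (p : E m) := by
  have hpos := cos_arcsin_pos h
  rw [← norm_sub_inner_smul] at hpos ⊢
  rw [equatorProj, coe_unitVec _ (norm_pos_iff.1 hpos), smul_smul, mul_inv_cancel₀ hpos.ne',
    one_smul]

theorem inner_equatorProj_eq_zero {p x : USphere m} (h : |⟪(p : E m), x⟫| < 1) {z : E m}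
    (hp : ⟪z, (p : E m)⟫ = 0) (hx : ⟪z, (x : E m)⟫ = 0) : ⟪z, (equatorProj p x : E m)⟫ = 0 := by
  have h' := congrArg (fun w => ⟪z, w⟫) (cos_smul_equatorProj h)
  simp only [inner_smul_right, inner_sub_right, hp, hx, mul_zero, sub_zero] at h'
  exact (mul_eq_zero.1 h').resolve_left (cos_arcsin_pos h).ne'

theorem inner_pole_equatorProj {p x : USphere m} (h : |⟪(p : E m), x⟫| < 1) :
    ⟪(p : E m), (equatorProj p x : E m)⟫ = 0 := by
  have h' := congrArg (fun w => ⟪(p : E m), w⟫) (cos_smul_equatorProj h)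
  simp only [inner_smul_right, inner_sub_right, real_inner_self_eq_norm_sq, norm_eq_of_mem_sphere,
    one_pow, mul_one, sub_self] at h'
  exact (mul_eq_zero.1 h').resolve_left (cos_arcsin_pos h).ne'

theorem cos_smul_equatorProj_add_sin_smul {p x : USphere m} (h : |⟪(p : E m), x⟫| < 1) :
    Real.cos (Real.arcsin ⟪(p : E m), x⟫) • (equatorProj p x : E m) +
      Real.sin (Real.arcsin ⟪(p : E m), x⟫) • (p : E m) = x := by
  rw [cos_smul_equatorProj h, Real.sin_arcsin (abs_le.1 h.le).1 (abs_le.1 h.le).2, sub_add_cancel]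

/-- A crude chord bound: `|sin θ| ≤ |θ|`, and `1 - cos θ ≤ θ² / 2 ≤ |θ|` because `|θ| ≤ 2`. -/
theorem dist_equatorProj_le {p x : USphere m} (h : |⟪(p : E m), x⟫| < 1) :
    dist x (equatorProj p x) ≤ 2 * |Real.arcsin ⟪(p : E m), x⟫| := by
  set θ := Real.arcsin ⟪(p : E m), x⟫ with hθ
  have hx : (x : E m) - (equatorProj p x : E m) =
      (Real.cos θ - 1) • (equatorProj p x : E m) + Real.sin θ • (p : E m) := by
    conv_lhs => rw [← cos_smul_equatorProj_add_sin_smul h]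
    rw [← hθ]
    module
  rw [Subtype.dist_eq, dist_eq_norm, hx]
  refine (norm_add_le _ _).trans ?_
  rw [norm_smul, norm_smul, norm_eq_of_mem_sphere, norm_eq_of_mem_sphere, mul_one, mul_one,
    Real.norm_eq_abs, Real.norm_eq_abs, abs_sub_comm, abs_of_nonneg (sub_nonneg.2 (Real.cos_le_one θ))]
  have h₁ := Real.one_sub_sq_div_two_le_cos (x := θ)
  have h₂ : |Real.sin θ| ≤ |θ| := Real.abs_sin_le_abs
  have h₃ : |θ| ≤ 2 := (abs_le.2 ⟨Real.neg_pi_div_two_le_arcsin _, Real.arcsin_le_pi_div_two _⟩).trans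
    (by linarith [Real.pi_le_four])
  nlinarith [sq_abs θ, abs_nonneg θ]

end EquatorProjection

/-! ### Rotations in a plane and their lifts -/

section PlaneRotation

variable {m : ℕ}

/-- The point of the circle through the orthonormal vectors `x`, `p` at angle `t` from `x`. -/
noncomputable def circlePt {x p : USphere m} (h : ⟪(x : E m), (p : E m)⟫ = 0) (t : ℝ) : USphere m :=
  ⟨Real.cos t • (x : E m) + Real.sin t • (p : E m), by
    rw [mem_sphere_zero_iff_norm, ← sq_eq_sq₀ (norm_nonneg _) zero_le_one, norm_add_sq_real]
    simp [norm_smul, inner_smul_left, inner_smul_right, h]⟩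

theorem continuous_circlePt {x p : USphere m} (h : ⟪(x : E m), (p : E m)⟫ = 0) :
    Continuous (circlePt h) := by
  unfold circlePt
  refine Continuous.subtype_mk ?_ _
  fun_prop

/-- The rotation by the angle `θ` in the plane of `x` and `p`, from `x` to `p`. -/
noncomputable def planeMap (x p : E m) (θ : ℝ) (f : E m) : E m :=
  f + ⟪x, f⟫ • ((Real.cos θ - 1) • x + Real.sin θ • p) +
    ⟪p, f⟫ • (-Real.sin θ • x + (Real.cos θ - 1) • p)

/-- The derivative of `planeMap` with respect to the angle. -/
noncomputable def planeDeriv (x p : E m) (θ : ℝ) (f : E m) : E m :=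
  ⟪x, f⟫ • (-Real.sin θ • x + Real.cos θ • p) + ⟪p, f⟫ • (-Real.cos θ • x - Real.sin θ • p)

/-- The lift to `Spin(m)` of the rotation by `θ` in the plane of `x` and `p`. -/
noncomputable def planeSpin {x p : USphere m} (h : ⟪(x : E m), (p : E m)⟫ = 0) (θ : ℝ) : Spin m :=
  spinPair (circlePt h (θ / 2)) x

theorem planeSpin_zero {x p : USphere m} (h : ⟪(x : E m), (p : E m)⟫ = 0) : planeSpin h 0 = 1 := by
  have : circlePt h (0 / 2) = x := Subtype.ext (by simp [circlePt])
  rw [planeSpin, this, spinPair_self]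

theorem continuous_planeSpin {x p : USphere m} (h : ⟪(x : E m), (p : E m)⟫ = 0) :
    Continuous (planeSpin h) := by
  have h₁ : Continuous fun θ : ℝ => (circlePt h (θ / 2), x) :=
    ((continuous_circlePt h).comp (by fun_prop)).prodMk continuous_const
  exact continuous_spinPair.comp h₁

/-- Two reflections whose axes form the angle `θ / 2` compose to the rotation by `θ`. -/
theorem spinRot_planeSpin {x p : USphere m} (h : ⟪(x : E m), (p : E m)⟫ = 0) (θ : ℝ) (f : E m) :
    spinRot (planeSpin h θ) f = planeMap x p θ f := by
  have hx : ‖(x : E m)‖ = 1 := norm_eq_of_mem_sphere x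
  have h' : ⟪(p : E m), (x : E m)⟫ = 0 := by rw [real_inner_comm, h]
  have hc : Real.cos θ = 2 * Real.cos (θ / 2) ^ 2 - 1 := by
    rw [← Real.cos_two_mul]; congr 1; ring
  have hs : Real.sin θ = 2 * Real.sin (θ / 2) * Real.cos (θ / 2) := by
    rw [← Real.sin_two_mul]; congr 1; ring
  have hsq : Real.cos (θ / 2) ^ 2 = 1 - Real.sin (θ / 2) ^ 2 := Real.cos_sq' _
  rw [planeSpin, spinRot_spinPair, vecRefl_apply_of_norm_eq_one hx,
    vecRefl_apply_of_norm_eq_one (norm_eq_of_mem_sphere _)]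
  simp only [circlePt, inner_add_left, inner_sub_right, real_inner_smul_left, inner_smul_right,
    real_inner_self_eq_norm_sq, hx, h', planeMap]
  rw [hc, hs]
  match_scalars
  · ring
  · ring
  · linear_combination (-2 * ⟪(p : E m), f⟫) * hsq

theorem planeMap_of_inner_eq_zero {x p f : E m} (hx : ⟪x, f⟫ = 0) (hp : ⟪p, f⟫ = 0) (θ : ℝ) :
    planeMap x p θ f = f := by
  simp [planeMap, hx, hp]

theorem planeMap_left {x p : E m} (hx : ‖x‖ = 1) (h : ⟪x, p⟫ = 0) (θ : ℝ) :
    planeMap x p θ x = Real.cos θ • x + Real.sin θ • p := by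
  rw [planeMap, real_inner_self_eq_norm_sq, hx, real_inner_comm, h]
  module

/-- The velocity is the orthogonal projection of `f` to the plane, turned by `θ` and a quarter turn.
-/
theorem norm_planeDeriv_sq {x p : E m} (hx : ‖x‖ = 1) (hp : ‖p‖ = 1) (h : ⟪x, p⟫ = 0) (θ : ℝ)
    (f : E m) : ‖planeDeriv x p θ f‖ ^ 2 = ⟪x, f⟫ ^ 2 + ⟪p, f⟫ ^ 2 := by
  have h' : ⟪p, x⟫ = 0 := by rw [real_inner_comm, h]
  have hxx : ⟪x, x⟫ = 1 := by rw [real_inner_self_eq_norm_sq, hx, one_pow]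
  have hpp : ⟪p, p⟫ = 1 := by rw [real_inner_self_eq_norm_sq, hp, one_pow]
  rw [← real_inner_self_eq_norm_sq, planeDeriv]
  simp only [inner_add_left, inner_add_right, inner_sub_left, inner_sub_right,
    real_inner_smul_left, real_inner_smul_right, hxx, hpp, h, h']
  linear_combination (⟪x, f⟫ ^ 2 + ⟪p, f⟫ ^ 2) * Real.sin_sq_add_cos_sq θ

/-- The argument `F` moves with `t` so that two rotations can be nested. -/
theorem hasDerivAt_planeMap (x p : E m) (θ : ℝ) {F : ℝ → E m} {F' : E m} {t : ℝ}
    (hF : HasDerivAt F F' t) :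
    HasDerivAt (fun t => planeMap x p (t * θ) (F t))
      (θ • planeDeriv x p (t * θ) (F t) + planeMap x p (t * θ) F') t := by
  have hθ : HasDerivAt (fun t : ℝ => t * θ) θ t := by simpa using (hasDerivAt_id t).mul_const θ
  have hc := hθ.cos
  have hs := hθ.sin
  have hx : HasDerivAt (fun t => ⟪x, F t⟫) ⟪x, F'⟫ t := by
    simpa using (hasDerivAt_const t x).inner ℝ hF
  have hp : HasDerivAt (fun t => ⟪p, F t⟫) ⟪p, F'⟫ t := by
    simpa using (hasDerivAt_const t p).inner ℝ hF
  convert! (hF.add (hx.smul (((hc.sub_const 1).smul_const x).add (hs.smul_const p)))).add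
    (hp.smul ((hs.neg.smul_const x).add ((hc.sub_const 1).smul_const p))) using 1
  simp only [planeDeriv, planeMap, Pi.add_apply, Pi.neg_apply]
  module

theorem ContDiff.planeMap (x p : E m) (θ : ℝ) {F : ℝ → E m} (hF : ContDiff ℝ 1 F) :
    ContDiff ℝ 1 fun t => planeMap x p (t * θ) (F t) := by
  have hx : ContDiff ℝ 1 fun t => ⟪x, F t⟫ := contDiff_const.inner ℝ hF
  have hp : ContDiff ℝ 1 fun t => ⟪p, F t⟫ := contDiff_const.inner ℝ hF
  unfold _root_.planeMap
  fun_prop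

end PlaneRotation

/-! ### Short paths to the preimage of the bi-equator -/

section Tube

variable {m : ℕ}

/-- The path that composes two plane rotations with a fixed element is `C¹`, of length at most
`√2` times the Euclidean norm of the two angles. -/
theorem isC1Path_and_pathLength_le {x p y q : USphere m} (h₁ : ⟪(x : E m), (p : E m)⟫ = 0)
    (h₂ : ⟪(y : E m), (q : E m)⟫ = 0) (θ φ : ℝ) (k : Spin m) :
    IsC1Path (fun t => planeSpin h₁ (t * θ) * planeSpin h₂ (t * φ) * k) ∧
    pathLength (fun t => planeSpin h₁ (t * θ) * planeSpin h₂ (t * φ) * k) ≤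
      √(2 * (θ ^ 2 + φ ^ 2)) := by
  have hrot (t : ℝ) (f : E m) : spinRot (planeSpin h₁ (t * θ) * planeSpin h₂ (t * φ) * k) f =
      planeMap x p (t * θ) (planeMap y q (t * φ) (spinRot k f)) := by
    rw [spinRot_mul, spinRot_mul, spinRot_planeSpin, spinRot_planeSpin]
  have hx := norm_eq_of_mem_sphere x
  have hp := norm_eq_of_mem_sphere p
  have hy := norm_eq_of_mem_sphere y
  have hq := norm_eq_of_mem_sphere q
  refine ⟨⟨?_, fun i => ?_⟩, ?_⟩
  · have hc₁ : Continuous fun t : ℝ => planeSpin h₁ (t * θ) :=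
      (continuous_planeSpin h₁).comp (by fun_prop)
    have hc₂ : Continuous fun t : ℝ => planeSpin h₂ (t * φ) :=
      (continuous_planeSpin h₂).comp (by fun_prop)
    exact (hc₁.mul hc₂).mul continuous_const
  · simp only [hrot]
    exact ContDiff.planeMap _ _ _ (ContDiff.planeMap _ _ _ contDiff_const)
  -- The constant 4 is 2 from `(r + s)² ≤ 2 (r² + s²)` times 2 from Parseval for the two unit
  -- vectors spanning each plane.
  · have hbound (t : ℝ) : ∑ i : Fin m, ‖deriv (fun s => spinRot
        (planeSpin h₁ (s * θ) * planeSpin h₂ (s * φ) * k) (EuclideanSpace.single i 1)) t‖ ^ 2 ≤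
        4 * (θ ^ 2 + φ ^ 2) := by
      have hi (i : Fin m) : ‖deriv (fun s => spinRot
          (planeSpin h₁ (s * θ) * planeSpin h₂ (s * φ) * k) (EuclideanSpace.single i 1)) t‖ ^ 2 ≤
          2 * (θ ^ 2 * (⟪(x : E m), spinRot (planeSpin h₂ (t * φ) * k) (EuclideanSpace.single i 1)⟫ ^ 2
            + ⟪(p : E m), spinRot (planeSpin h₂ (t * φ) * k) (EuclideanSpace.single i 1)⟫ ^ 2)) +
          2 * (φ ^ 2 * (⟪(y : E m), spinRot k (EuclideanSpace.single i 1)⟫ ^ 2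
            + ⟪(q : E m), spinRot k (EuclideanSpace.single i 1)⟫ ^ 2)) := by
        have hd := hasDerivAt_planeMap (x : E m) p θ (hasDerivAt_planeMap (y : E m) q φ
          (hasDerivAt_const t (spinRot k (EuclideanSpace.single i 1))))
        simp only [hrot, hd.deriv]
        have hz : planeMap (y : E m) q (t * φ) 0 = 0 := by simp [planeMap]
        rw [hz, add_zero, ← spinRot_planeSpin h₁, ← spinRot_planeSpin h₂, ← spinRot_mul]
        rw [← norm_planeDeriv_sq hx hp h₁ (t * θ), ← norm_planeDeriv_sq hy hq h₂ (t * φ)]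
        refine (pow_le_pow_left₀ (norm_nonneg _) (norm_add_le _ _) 2).trans ?_
        rw [LinearIsometry.norm_map, norm_smul, norm_smul]
        refine (add_sq_le).trans (le_of_eq ?_)
        rw [mul_pow, mul_pow, Real.norm_eq_abs, Real.norm_eq_abs, sq_abs, sq_abs]
        ring
      refine (Finset.sum_le_sum fun i _ => hi i).trans (le_of_eq ?_)
      simp only [Finset.sum_add_distrib, ← Finset.mul_sum, sum_inner_spinRot_sq, hx, hp, hy, hq]
      ring
    have := intervalIntegral.norm_integral_le_of_norm_le_const (a := 0) (b := 1)
      (f := fun t => √((∑ i : Fin m, ‖deriv (fun s => spinRot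
        (planeSpin h₁ (s * θ) * planeSpin h₂ (s * φ) * k) (EuclideanSpace.single i 1)) t‖ ^ 2) / 2))
      (C := √(2 * (θ ^ 2 + φ ^ 2))) fun t _ => by
        rw [Real.norm_eq_abs, abs_of_nonneg (Real.sqrt_nonneg _)]
        refine Real.sqrt_le_sqrt ?_
        linarith [hbound t]
    rw [sub_zero, abs_one, mul_one] at this
    exact (le_abs_self _).trans this

variable (Φ : ProductIdentification m) (a : USphere (m + 2)) (b : USphere (m + 1))

/-- The pole of the fibre over the projection of `u` to the equator of `a`, carried back to the
fibre over `u` by the rotation from the projection to `u`. -/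
noncomputable def carriedPole (u : USphere (m + 2)) : E (m + 2) :=
  open Classical in
  if |⟪(a : E (m + 2)), u⟫| < 1 then
    planeMap (equatorProj a u) a (Real.arcsin ⟪(a : E (m + 2)), u⟫)
      (fibrePole Φ b (equatorProj a u))
  else 0

theorem inner_equatorProj_pole {p x : USphere m} (h : |⟪(p : E m), x⟫| < 1) :
    ⟪(equatorProj p x : E m), (p : E m)⟫ = 0 := by
  rw [real_inner_comm, inner_pole_equatorProj h]

theorem norm_carriedPole_le (u : USphere (m + 2)) : ‖carriedPole Φ a b u‖ ≤ 1 := by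
  rw [carriedPole]
  split_ifs with h
  · rw [← spinRot_planeSpin (inner_equatorProj_pole h), LinearIsometry.norm_map,
      norm_eq_of_mem_sphere]
  · simp

theorem measurable_carriedPole : Measurable (carriedPole Φ a b) := by
  classical
  have h₁ := measurable_equatorProj a
  have h₂ : Measurable fun u => (equatorProj a u : E (m + 2)) := measurable_subtype_coe.comp h₁
  have h₃ : Measurable fun u => (fibrePole Φ b (equatorProj a u) : E (m + 2)) :=
    measurable_subtype_coe.comp ((measurable_fibrePole Φ b).comp h₁)
  have h₄ : Measurable fun u : USphere (m + 2) => ⟪(a : E (m + 2)), u⟫ := by fun_prop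
  have h₅ : Measurable fun u : USphere (m + 2) => Real.arcsin ⟪(a : E (m + 2)), u⟫ :=
    Real.measurable_arcsin.comp h₄
  unfold carriedPole
  refine Measurable.ite (measurableSet_lt h₄.abs measurable_const) ?_ measurable_const
  unfold planeMap
  have h₆ := Real.measurable_cos.comp h₅
  have h₇ := Real.measurable_sin.comp h₅
  simp only [Function.comp_def] at h₆ h₇
  fun_prop

/-- Undoing two small rotations takes `g` to a point `k` of the preimage: the first brings `g e₀` to
the equator of `a`, the second brings the second frame vector to the equator of the fibre pole
there. -/
theorem mem_spinTube_of_small {ε : ℝ} (hε : 0 < ε) {g : Spin (m + 2)}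
    (ha : |⟪(a : E (m + 2)), spinAct g (basisPt 0)⟫| < 1)
    (ha' : |Real.arcsin ⟪(a : E (m + 2)), spinAct g (basisPt 0)⟫| < ε / 4)
    (hb : |⟪carriedPole Φ a b (spinAct g (basisPt 0)),
      spinRot g (EuclideanSpace.single 1 1)⟫| < 1)
    (hb' : |Real.arcsin ⟪carriedPole Φ a b (spinAct g (basisPt 0)),
      spinRot g (EuclideanSpace.single 1 1)⟫| < ε / 4) :
    g ∈ spinTube ε (biEquatorPreimage Φ a b) := by
  set u := spinAct g (basisPt 0) with hu
  set x := equatorProj a u with hx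
  set θ := Real.arcsin ⟪(a : E (m + 2)), u⟫ with hθ
  have h₁ : ⟪(x : E (m + 2)), (a : E (m + 2))⟫ = 0 := inner_equatorProj_pole ha
  set β := fibrePole Φ b x with hβ
  let g' := (planeSpin h₁ θ)⁻¹ * g
  have hg' : planeSpin h₁ θ * g' = g := mul_inv_cancel_left _ _
  have hg'₀ : spinAct g' (basisPt 0) = x := by
    have : spinAct (planeSpin h₁ θ) x = u := by
      apply Subtype.ext
      rw [coe_spinAct, spinRot_planeSpin, planeMap_left (norm_eq_of_mem_sphere x) h₁]
      exact cos_smul_equatorProj_add_sin_smul ha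
    rw [spinAct_mul, ← hu, ← this, spinAct_inv_spinAct]
  let v := spinAct g' (basisPt 1)
  -- The rotation that carries `β` back over `u` also carries `v` to `g e₁`, so it drops out of the
  -- inner product.
  have hinner : ⟪carriedPole Φ a b u, spinRot g (EuclideanSpace.single 1 1)⟫ =
      ⟪(β : E (m + 2)), (v : E (m + 2))⟫ := by
    rw [carriedPole, if_pos ha, ← hx, ← hθ, ← hβ, ← spinRot_planeSpin h₁, ← hg', spinRot_mul,
      LinearIsometry.inner_map_map]
    rfl
  rw [hinner] at hb hb'
  set φ := Real.arcsin ⟪(β : E (m + 2)), v⟫ with hφ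
  set y := equatorProj β v with hy
  have h₂ : ⟪(y : E (m + 2)), (β : E (m + 2))⟫ = 0 := inner_equatorProj_pole hb
  let k := (planeSpin h₂ φ)⁻¹ * g'
  have hk : planeSpin h₂ φ * k = g' := mul_inv_cancel_left _ _
  have hxβ : ⟪(x : E (m + 2)), (β : E (m + 2))⟫ = 0 := inner_fibrePole Φ x b
  have hxv : ⟪(x : E (m + 2)), (v : E (m + 2))⟫ = 0 := by
    rw [← hg'₀, coe_spinAct, coe_spinAct, LinearIsometry.inner_map_map,
      inner_basisPt_zero_basisPt_one]
  -- The second rotation takes place in the plane of `y` and `β`, both orthogonal to `x`, so it does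
  -- not disturb the first frame vector.
  have hxy : ⟪(x : E (m + 2)), (y : E (m + 2))⟫ = 0 := inner_equatorProj_eq_zero hb hxβ hxv
  have hk₀ : spinAct k (basisPt 0) = x := by
    have : spinAct (planeSpin h₂ φ) x = x := by
      apply Subtype.ext
      rw [coe_spinAct, spinRot_planeSpin, planeMap_of_inner_eq_zero]
      · rw [real_inner_comm, hxy]
      · rw [real_inner_comm, hxβ]
    rw [spinAct_mul, hg'₀]
    conv_lhs => rw [← this]
    rw [spinAct_inv_spinAct]
  have hk₁ : spinAct k (basisPt 1) = y := by
    have : spinAct (planeSpin h₂ φ) y = v := by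
      apply Subtype.ext
      rw [coe_spinAct, spinRot_planeSpin, planeMap_left (norm_eq_of_mem_sphere y) h₂]
      exact cos_smul_equatorProj_add_sin_smul hb
    rw [spinAct_mul]
    change spinAct _ v = y
    rw [← this, spinAct_inv_spinAct]
  obtain ⟨hpath, hlen⟩ := isC1Path_and_pathLength_le h₁ h₂ θ φ k
  refine ⟨_, hpath, ?_, ?_, hlen.trans_lt ?_⟩
  · simp only [zero_mul, planeSpin_zero, one_mul]
    refine ⟨?_, ?_⟩
    · change ⟪(a : E (m + 2)), (spinProj Φ k).1⟫ = 0
      rw [spinProj_fst, hk₀, real_inner_comm, h₁]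
    · change ⟪(b : E (m + 1)), (spinProj Φ k).2⟫ = 0
      rw [inner_spinProj_snd, hk₀, ← hβ, ← coe_basisPt, ← coe_spinAct, hk₁, real_inner_comm, h₂]
  · simp only [one_mul]
    rw [mul_assoc, hk, hg']
  -- With both angles below `ε / 4`, the squared length is below `ε² / 4`.
  · rw [Real.sqrt_lt' hε]
    have e₁ : θ ^ 2 < (ε / 4) ^ 2 := sq_lt_sq' (abs_lt.1 ha').1 (abs_lt.1 ha').2
    have e₂ : φ ^ 2 < (ε / 4) ^ 2 := sq_lt_sq' (abs_lt.1 hb').1 (abs_lt.1 hb').2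
    nlinarith

theorem mem_thickening_biEquator_of_small {ε : ℝ} {q : USphere (m + 2) × USphere (m + 1)}
    (ha : |⟪(a : E (m + 2)), q.1⟫| < 1)
    (ha' : |Real.arcsin ⟪(a : E (m + 2)), q.1⟫| < ε / 4)
    (hb : |⟪(b : E (m + 1)), q.2⟫| < 1)
    (hb' : |Real.arcsin ⟪(b : E (m + 1)), q.2⟫| < ε / 4) :
    q ∈ Metric.thickening ε (biEquator a b) := by
  rw [Metric.mem_thickening_iff]
  refine ⟨(equatorProj a q.1, equatorProj b q.2), ⟨inner_pole_equatorProj ha,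
    inner_pole_equatorProj hb⟩, max_lt ?_ ?_⟩
  · have := dist_equatorProj_le ha
    have := abs_nonneg (Real.arcsin ⟪(a : E (m + 2)), q.1⟫)
    change dist q.1 (equatorProj a q.1) < ε
    linarith
  · have := dist_equatorProj_le hb
    have := abs_nonneg (Real.arcsin ⟪(b : E (m + 1)), q.2⟫)
    change dist q.2 (equatorProj b q.2) < ε
    linarith

theorem exists_abs_arcsin_lt {η : ℝ} (hη : 0 < η) :
    ∃ δ : ℝ, 0 < δ ∧ δ ≤ 1 ∧ ∀ s, |s| < δ → |Real.arcsin s| < η := by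
  obtain ⟨δ, hδ, h⟩ := Metric.continuousAt_iff.1 (Real.continuous_arcsin.continuousAt (x := 0)) η hη
  refine ⟨min δ 1, by positivity, min_le_right _ _, fun s hs => ?_⟩
  simpa [Real.dist_eq] using h (x := s) (by simpa [Real.dist_eq] using hs.trans_le (min_le_left _ _))

/-- Each complement is covered by two Chebyshev events, one per height. Monotonicity of the outer
measure suffices, so the tube need not be shown measurable. -/
theorem measure_compl_neighbourhoods_le (hm : 1 ≤ m) (μ : Measure (Spin (m + 2)))
    [IsProbabilityMeasure μ] [μ.IsMulLeftInvariant] {ε δ : ℝ} (hε : 0 < ε) (hδ : 0 < δ)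
    (hδ1 : δ ≤ 1) (h : ∀ s, |s| < δ → |Real.arcsin s| < ε / 4) :
    μ (spinProj Φ ⁻¹' Metric.thickening ε (biEquator a b))ᶜ ≤
      2 * (ENNReal.ofReal ((m + 1) * δ ^ 2))⁻¹ ∧
    μ (spinTube ε (biEquatorPreimage Φ a b))ᶜ ≤ 2 * (ENNReal.ofReal ((m + 1) * δ ^ 2))⁻¹ := by
  have hzero := measure_le_abs_inner_zero_le hm μ a hδ
  constructor
  · have hF : Measurable fun u => (fibrePole Φ b u : E (m + 2)) :=
      measurable_subtype_coe.comp (measurable_fibrePole Φ b)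
    have hone := measure_le_abs_inner_one_le hm μ hF (fun u => (norm_eq_of_mem_sphere _).le) hδ
    rw [two_mul]
    refine le_trans (measure_mono fun g hg => ?_)
      ((measure_union_le _ _).trans (add_le_add hzero hone))
    by_contra hcon
    simp only [mem_union, mem_ofPred_eq, not_or, not_le] at hcon
    refine hg ?_
    have h₁ := hcon.1
    have h₂ := hcon.2
    rw [← spinProj_fst Φ] at h₁
    rw [← inner_spinProj_snd] at h₂
    exact mem_thickening_biEquator_of_small a b (h₁.trans_le hδ1) (h _ h₁) (h₂.trans_le hδ1) (h _ h₂)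
  · have hone := measure_le_abs_inner_one_le hm μ (measurable_carriedPole Φ a b)
      (norm_carriedPole_le Φ a b) hδ
    rw [two_mul]
    refine le_trans (measure_mono fun g hg => ?_)
      ((measure_union_le _ _).trans (add_le_add hzero hone))
    by_contra hcon
    simp only [mem_union, mem_ofPred_eq, not_or, not_le] at hcon
    exact hg (mem_spinTube_of_small Φ a b hε (hcon.1.trans_le hδ1) (h _ hcon.1)
      (hcon.2.trans_le hδ1) (h _ hcon.2))

end Tube

/-! ### The limit and the assembled theorem -/

theorem tendsto_measure_compl_neighbourhoods (μ : ∀ n : ℕ, Measure (Spin (2 * n + 2)))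
    (hμ : ∀ n, IsProbabilityMeasure (μ n)) (hμ' : ∀ n, (μ n).IsMulLeftInvariant)
    (Φ : ∀ n : ℕ, ProductIdentification (2 * n))
    (a : ∀ n : ℕ, USphere (2 * n + 2)) (b : ∀ n : ℕ, USphere (2 * n + 1))
    (ε : ℝ) (hε : 0 < ε) :
    Tendsto (fun n => μ n (spinProj (Φ n) ⁻¹'
      Metric.thickening ε (biEquator (a n) (b n)))ᶜ) atTop (𝓝 0) ∧
    Tendsto (fun n => μ n (spinTube ε (biEquatorPreimage (Φ n) (a n) (b n)))ᶜ)
      atTop (𝓝 0) := by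
  -- The threshold `δ` depends on `ε` alone, so the bound tends to 0 uniformly in the
  -- identifications and the poles.
  obtain ⟨δ, hδ, hδ1, h⟩ := exists_abs_arcsin_lt (η := ε / 4) (by positivity)
  have hlim : Tendsto (fun n : ℕ => 2 * (ENNReal.ofReal (((2 * n : ℕ) + 1) * δ ^ 2))⁻¹) atTop
      (𝓝 0) := by
    have h₁ : Tendsto (fun n : ℕ => (((2 * n : ℕ) : ℝ) + 1) * δ ^ 2) atTop atTop := by
      refine Tendsto.atTop_mul_const (by positivity) (tendsto_atTop_add_const_right _ _ ?_)
      exact tendsto_natCast_atTop_atTop.comp (tendsto_id.const_mul_atTop' (by norm_num))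
    have h₂ := ENNReal.Tendsto.const_mul (a := 2)
      (tendsto_inv_iff.2 (ENNReal.tendsto_ofReal_atTop.comp h₁)) (Or.inr (by simp))
    simpa using h₂
  have hev : ∀ᶠ n : ℕ in atTop, 1 ≤ 2 * n := by
    filter_upwards [eventually_ge_atTop 1] with n hn
    omega
  constructor
  · refine tendsto_of_tendsto_of_tendsto_of_le_of_le' tendsto_const_nhds hlim
      (Eventually.of_forall fun n => zero_le) ?_
    filter_upwards [hev] with n hn
    exact (measure_compl_neighbourhoods_le (Φ n) (a n) (b n) hn (μ n) hε hδ hδ1 h).1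
  · refine tendsto_of_tendsto_of_tendsto_of_le_of_le' tendsto_const_nhds hlim
      (Eventually.of_forall fun n => zero_le) ?_
    filter_upwards [hev] with n hn
    exact (measure_compl_neighbourhoods_le (Φ n) (a n) (b n) hn (μ n) hε hδ hδ1 h).2

theorem mainTheorem5 :
    -- `Spin(2n+2)` is a `Spin(2n)`-fibration over `Spin(2n+2) / Spin(2n)`,
    -- and the latter is `S^(2n+1) × S^(2n)`
    (∀ n : ℕ, 1 ≤ n →
      IsEmbedding (spinIncl (2 * n)) ∧
      (∃ e : (Spin (2 * n + 2) ⧸ (spinIncl (2 * n)).range) ≃ₜ TwoFrames (2 * n),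
        ∀ g : Spin (2 * n + 2), e (QuotientGroup.mk g) = spinFrame (2 * n) g) ∧
      (∀ p : TwoFrames (2 * n),
        ∃ τ : Bundle.Trivialization (Spin (2 * n)) (spinFrame (2 * n)), p ∈ τ.baseSet) ∧
      (∃ (Φ : ProductIdentification (2 * n)) (c : USphere (2 * n + 2)),
        ContinuousOn Φ.toMeasurableEquiv {p | p.1.1 ≠ c} ∧
        ContinuousOn Φ.toMeasurableEquiv.symm {q | q.1 ≠ c})) ∧
    -- the bi-equator is `S^(2n) × S^(2n-1)`, of codimension two
    (∀ (n : ℕ) (a : USphere (2 * n + 2)) (b : USphere (2 * n + 1)),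
      Nonempty (biEquator a b ≃ₜ USphere (2 * n + 1) × USphere (2 * n))) ∧
    -- the normalised invariant measure of `Spin(2n+2)`
    (∀ n : ℕ, ∃! μ : Measure (Spin (2 * n + 2)),
      IsProbabilityMeasure μ ∧ μ.IsMulLeftInvariant) ∧
    -- it concentrates on the preimage of any bi-equator
    (∀ (μ : ∀ n : ℕ, Measure (Spin (2 * n + 2)))
      (_ : ∀ n, IsProbabilityMeasure (μ n)) (_ : ∀ n, (μ n).IsMulLeftInvariant)
      (Φ : ∀ n : ℕ, ProductIdentification (2 * n))
      (a : ∀ n : ℕ, USphere (2 * n + 2)) (b : ∀ n : ℕ, USphere (2 * n + 1))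
      (ε : ℝ) (_ : 0 < ε),
      Tendsto (fun n => μ n (spinProj (Φ n) ⁻¹'
        Metric.thickening ε (biEquator (a n) (b n)))ᶜ) atTop (𝓝 0) ∧
      Tendsto (fun n => μ n (spinTube ε (biEquatorPreimage (Φ n) (a n) (b n)))ᶜ)
        atTop (𝓝 0)) := by
  refine ⟨fun n hn => ?_, fun n a b => nonempty_biEquator_homeomorph a b,
    fun n => existsUnique_haar_spin (by omega), tendsto_measure_compl_neighbourhoods⟩
  have hm : 1 ≤ 2 * n := by omega
  exact ⟨isEmbedding_spinIncl hm, exists_homeomorph_quotient_twoFrames hm,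
    exists_trivialization_spinFrame hm, exists_identification_continuousOn _⟩
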